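/- **Lemma 6.1.** Let $k$ be a $p$-adic field (a non-archimedean local field of characteristic $0$) with normalised absolute value $|\cdot|$, let $\psi$ be a non-trivial continuous unitary additive character of $k$, and let $T\cong\mathbb{G}_m^r$ be a split torus over $k$. Let $\mu_1,\dots,\mu_n\in X_*(T)$ be cocharacters (the weights of an $n$-dimensional representation $\rho_T$ of the dual torus $\hat T$), not necessarily distinct, and suppose that there is a character $\nu\in X^*(T)$ with $\langle\nu,\mu_i\rangle=1$ for all $i$. Put $T_n=\mathbb{G}_m^n$, $\tilde\mu:T_n\to T$, $\tilde\mu(x_1,\dots,x_n)=\mu_1(x_1)\cdots\mu_n(x_n)$, and $U=\ker\tilde\mu$. Fix Haar measures $dx$ on $T_n(k)$ and $du$ on $U(k)$. For $t\in T(k)$ carry $du$ to the fibre $\tilde\mu^{-1}(t)\subset T_n(k)$ by translation (an integral over an empty fibre is $0$), and define the push-forward $$\rho_*f(t)=\int_{\tilde\mu^{-1}(t)}f(x)\,dx,\qquad\text{so that}\qquad \rho_*f(\tilde\mu(x))=\int_{U(k)}f(ux)\,du .$$ Let $dt$ be a quotient measure on $T(k)$, i.e. one such that $\int_{T(k)}\rho_*f(t)\,dt=\int_{T_n(k)}f(x)\,dx$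 for all $f\in C_c(T_n(k))$. (If the $\mu_i$ span $X_*(T)\otimes\mathbb{Q}$, so that $T=T_n/U$, then the suitably normalised Haar measure of $T(k)$ is such a measure.) Write $d^+x=|x_1\cdots x_n|\,dx$, an additive Haar measure of $k^n$ restricted to $T_n(k)$, and $d^+t=|\nu(t)|\,dt$. Let $\mathcal{S}^{\mathrm{std}}(T_n)$ be the space of restrictions to $T_n(k)=(k^\times)^n$ of locally constant compactly supported functions on $k^n$; for $\phi\in\mathcal{S}^{\mathrm{std}}(T_n)$ put $\tilde\phi=\rho_*\phi$. For a function $f$ on a group put $f^\vee(g)=f(g^{-1})$, and for a measure $K$ put $(K\star f)(g)=\int f(h^{-1}g)\,dK(h)$. Let $h_\psi(x)=\psi(x_1+\dots+x_n)$, let $J^{\mathrm{std}}$ be the measure $h_\psi(x)\,d^+x$ on $T_n(k)$, and let Ngo's kernel be the principal value $$J^{\rho_T}(t)=\lim_{R\to\infty}\int_{x\in\tilde\mu^{-1}(t),\ \max_i|x_i|\le R}h_\psi(x)\,dx ,$$ regarded as the measure $J^{\rho_T}(t)\,d^+t$ when it is used in a convolution. Then the limit defining $J^{\rho_T}(t)$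 exists for almost every $t\in T(k)$. Moreover, for every $\phi\in\mathcal{S}^{\mathrm{std}}(T_n)$, the integrals defining $\tilde\phi$, $J^{\mathrm{std}}\star\phi^\vee$, $\rho_*(J^{\mathrm{std}}\star\phi^\vee)$ and $J^{\rho_T}\star\tilde\phi^\vee$ converge absolutely at every point, and $$\rho_*\bigl(J^{\mathrm{std}}\star\phi^\vee\bigr)=J^{\rho_T}\star\tilde\phi^\vee\qquad\text{on } T(k).$$ Also (equivalently), push-forward intertwines the standard Fourier transform with Ngo's Fourier transform: with $$\mathcal{F}^{\mathrm{std}}\phi(x)=\int_{T_n(k)}h_\psi(xy)\,\phi(y)\,d^+y,\qquad \mathcal{F}^{\rho_T}f(t)=\int_{T(k)}J^{\rho_T}(ts)\,f(s)\,d^+s ,$$ one has $\rho_*(\mathcal{F}^{\mathrm{std}}\phi)=\mathcal{F}^{\rho_T}(\rho_*\phi)$ on $T(k)$. -/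

import Mathlib

open MeasureTheory Filter Topology

noncomputable section

namespace TorusFourier

section Tori

variable {k : Type*} [Field k] {n r : ℕ}

/-- The homomorphism `G_m^n → T = G_m^r` on `k`-points attached to cocharacters
`w 0, …, w (n-1)` of `T`, where `X_*(T) = ℤ^r`: `x ↦ w_0(x_0) ⋯ w_{n-1}(x_{n-1})`. -/
def dualMap (w : Fin n → Fin r → ℤ) : (Fin n → kˣ) →* (Fin r → kˣ) where
  toFun x j := ∏ i, x i ^ w i j
  map_one' := by
    funext j
    simp
  map_mul' x y := by
    funext j
    simp [mul_zpow, Finset.prod_mul_distrib]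

/-- The value at `t ∈ T(k)` of the character of `T = G_m^r` with exponents `ν`. -/
def charEval (ν : Fin r → ℤ) (t : Fin r → kˣ) : kˣ := ∏ j, t j ^ ν j

/-- The function `h_ψ(x) = ψ(x_1 + ⋯ + x_n)` on `T_n(k) = (k^×)^n`. -/
def hPsi (ψ : AddChar k Circle) (x : Fin n → kˣ) : ℂ := (ψ (∑ i, (x i : k)) : ℂ)

/-- The space `S^std(T_n)`: restrictions to `T_n(k) = (k^×)^n` of locally constant compactly
supported functions on `k^n`. -/
def IsStdSchwartz [TopologicalSpace k] (φ : (Fin n → kˣ) → ℂ) : Prop :=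
  ∃ Φ : (Fin n → k) → ℂ, IsLocallyConstant Φ ∧ HasCompactSupport Φ ∧
    ∀ x : Fin n → kˣ, φ x = Φ (fun i => (x i : k))

end Tori

/-- Convolution `(K ⋆ f)(g) = ∫ K(h) f(h⁻¹ g) dh` on a group, with respect to `m = dh`. -/
def mulConv {G : Type*} [Group G] [MeasurableSpace G] (m : Measure G) (K f : G → ℂ) (g : G) : ℂ :=
  ∫ h, K h * f (h⁻¹ * g) ∂m

/-- `f^∨(g) = f(g⁻¹)`. -/
def check {G : Type*} [Group G] (f : G → ℂ) (g : G) : ℂ := f g⁻¹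

section Fibres

variable {k : Type*} [Field k] [MeasurableSpace k] {n r : ℕ}

open Classical in
/-- The measure on the fibre over `t` of the map `T_n(k) → T(k)`: the translate to the fibre of the
Haar measure `mU` of the kernel `U(k)` (for `mU` invariant, it does not depend on the
point of the fibre used to translate), and zero if the fibre is empty. -/
def fibreMeasure (w : Fin n → Fin r → ℤ) (mU : Measure (dualMap (k := k) w).ker)
    (t : Fin r → kˣ) : Measure (Fin n → kˣ) :=
  if h : ∃ x : Fin n → kˣ, dualMap w x = t then
    mU.map (fun u : (dualMap (k := k) w).ker => (u : Fin n → kˣ) * h.choose)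
  else 0

/-- The push-forward `ρ_* f (t) = ∫_{x ↦ t} f(x) dx`, an integral over the fibre over `t`.
At the image of `x` this is `∫_{U(k)} f(u x) du`. -/
def pushforward (w : Fin n → Fin r → ℤ) (mU : Measure (dualMap (k := k) w).ker)
    (f : (Fin n → kˣ) → ℂ) (t : Fin r → kˣ) : ℂ :=
  ∫ x, f x ∂(fibreMeasure w mU t)

/-- `mT` is the quotient measure of `mn` by `mU` on `T(k) ⊇ T_n(k)/U(k)`: integrating over the
fibres and then over `T(k)` is integrating over `T_n(k)`. If `T_n → T` is surjective as a map
of algebraic tori, the suitably normalised Haar measure of `T(k)` is such a measure. -/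
def IsQuotientMeasure [TopologicalSpace k] (w : Fin n → Fin r → ℤ)
    (mn : Measure (Fin n → kˣ)) (mU : Measure (dualMap (k := k) w).ker)
    (mT : Measure (Fin r → kˣ)) : Prop :=
  ∀ f : (Fin n → kˣ) → ℂ, Continuous f → HasCompactSupport f →
    ∫ t, pushforward w mU f t ∂mT = ∫ x, f x ∂mn

end Fibres

section Fourier

variable {k : Type*} [NontriviallyNormedField k] [LocallyCompactSpace k] {n r : ℕ}

/-- The normalised absolute value of `x ∈ k^×`: the factor by which multiplication
by `x` scales an additive Haar measure of `k`. -/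
def normAbs (x : kˣ) : ℝ := (distribHaarChar k x : ℝ)

/-- The kernel `J^std` on `T_n(k)`, as a density with respect to the Haar measure:
`J^std(x) = ψ(tr x) |det x|` for `x` the diagonal matrix with entries `x_i`, so that
`J^std(x) dx = h_ψ(x) d⁺x` with `d⁺x = ∏ |x_i| dx` an additive Haar measure of `k^n`. -/
def stdKernel (ψ : AddChar k Circle) (x : Fin n → kˣ) : ℂ :=
  hPsi ψ x * (normAbs (∏ i, x i) : ℂ)

variable [MeasurableSpace k]

/-- The standard Fourier transform on `T_n(k)`: `φ ↦ ∫ h_ψ(x y) φ(y) d⁺y`. -/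
def stdFourier (ψ : AddChar k Circle) (mn : Measure (Fin n → kˣ))
    (φ : (Fin n → kˣ) → ℂ) (x : Fin n → kˣ) : ℂ :=
  ∫ y, hPsi ψ (x * y) * φ y * (normAbs (∏ i, y i) : ℂ) ∂mn

/-- The truncated fibre integral `∫ h_ψ(x) dx` over the `x` above `t` with all `‖x_i‖ ≤ R`. -/
def truncKernel (w : Fin n → Fin r → ℤ) (ψ : AddChar k Circle)
    (mU : Measure (dualMap (k := k) w).ker) (R : ℝ) (t : Fin r → kˣ) : ℂ :=
  ∫ x in {x : Fin n → kˣ | ∀ i, ‖(x i : k)‖ ≤ R}, hPsi ψ x ∂(fibreMeasure w mU t)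

/-- Ngo's kernel `J^{ρ_T}(t) = ∫_{x ↦ t} h_ψ(x) dx`, a principal value integral over the fibre. -/
def torusKernel (w : Fin n → Fin r → ℤ) (ψ : AddChar k Circle)
    (mU : Measure (dualMap (k := k) w).ker) (t : Fin r → kˣ) : ℂ :=
  limUnder atTop (fun R : ℝ => truncKernel w ψ mU R t)

/-- The density of the measure `J^{ρ_T}(t) d⁺t` with respect to `dt`, where `d⁺t = |ν(t)| dt`
corresponds to the measure `d⁺x = |x_1 ⋯ x_n| dx` of `T_n(k)`, as `x_1 ⋯ x_n = ν(t)` if `x ↦ t`. -/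
def torusKernelDensity (w : Fin n → Fin r → ℤ) (ν : Fin r → ℤ) (ψ : AddChar k Circle)
    (mU : Measure (dualMap (k := k) w).ker) (t : Fin r → kˣ) : ℂ :=
  torusKernel w ψ mU t * (normAbs (charEval ν t) : ℂ)

/-- The `ρ_T`-Fourier transform on `T(k)`: `f ↦ ∫ J^{ρ_T}(t s) f(s) d⁺s`, `d⁺s = |ν(s)| ds`. -/
def torusFourier (w : Fin n → Fin r → ℤ) (ν : Fin r → ℤ) (ψ : AddChar k Circle)
    (mU : Measure (dualMap (k := k) w).ker) (mT : Measure (Fin r → kˣ))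
    (f : (Fin r → kˣ) → ℂ) (t : Fin r → kˣ) : ℂ :=
  ∫ s, torusKernel w ψ mU (t * s) * f s * (normAbs (charEval ν s) : ℂ) ∂mT

end Fourier

end TorusFourier

end

/-! The identity is Fubini's theorem for $h_\psi(yx)\phi(x)$ over $U(k)\times T_n(k)$. Formally,
integrating $J^{\rho_T}$ against $\rho_*\phi$ unfolds to integrating $h_\psi(uyx)\phi(x)$ over $u$
and $d^+x$; taking the integral over $x$ first gives $\mathcal F^{\mathrm{std}}\phi(uy)$, and the
integral over $u$ is then $\rho_*(\mathcal F^{\mathrm{std}}\phi)$. The convolution form is the same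
identity multiplied by $|\nu(t)|$, since $J^{\mathrm{std}}\star\phi^\vee(x)=|x_1\cdots
x_n|\,\mathcal F^{\mathrm{std}}\phi(x)$ and $x_1\cdots x_n=\nu(t)$ on the fibre over $t$. The
difficulty is that the kernel converges only conditionally.

Truncation at $\max_i|x_i|\le R$ makes Fubini legitimate: the product of the coordinates is fixed on
a fibre, so a truncated fibre meets only finitely many compact shells of given valuations
(`integral_truncKernel_mul`). On the Fourier side the truncation has no effect once $R$ is large,
uniformly in the point (`IsStdSchwartz.exists_fourier`). It remains to let $R\to\infty$ on the
kernel side, which needs a dominating function.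

That function is `absKernel`, the sum over the shells of a fibre of the absolute values of the
integrals of $h_\psi$. It is shown to be integrable over every polydisc
(`lintegral_absKernel_lt_top`) by a second moment estimate. A shell of a fibre is either empty or
one orbit of the compact group $U^0$ of points of $U(k)$ with unit coordinates. The mean square over
$x$ in a shell $v$ of the orbit integral is a double integral over $u,u'\in U^0$ of the integral of
$\psi(\sum_j(u_j-u'_j)x_j)$. The last vanishes unless $u_i$ and $u'_i$ agree to order about $-v_i$,
for every $i$ (`integral_shell_addChar_eq_zero`). If some relation $\sum_i l_i\mu_i=0$ has
$l_i\ne0$, then $U$ contains the points $(s^{l_j})_j$, whose $i$-th coordinate varies, and the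
volume of the pairs that are close in that coordinate decays exponentially
(`exists_measure_kerUnitsNear_le`; characteristic $0$ ensures $l_i\neq0$ in $k$). Deep shells of a
fibre are reached only by a $u\in U(k)$ that changes the valuation of the coordinate in question,
and the valuations of $u$ are themselves such a relation. Together with the factor $|x_1\cdots x_n|$
in $d^+x$, this decay makes the double sum over shells converge (`zpow_mul_zpow_le`). -/

set_option linter.unusedSectionVars false

noncomputable section

namespace TorusFourier

/-! ### Topology and Borel structure of $k^\times$. -/

section Instances

variable {k : Type*} [NontriviallyNormedField k] [LocallyCompactSpace k]

instance properSpace_of_locallyCompact : ProperSpace k := ProperSpace.of_locallyCompactSpace k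

instance units_secondCountable : SecondCountableTopology kˣ :=
  Units.isOpenEmbedding_val.isEmbedding.secondCountableTopology

instance units_polishSpace : PolishSpace kˣ := by
  have h : IsOpen (Set.range (Units.val : kˣ → k)) := Units.isOpenEmbedding_val.isOpen_range
  have := h.polishSpace
  exact (Units.isOpenEmbedding_val (R := k)).isEmbedding.toHomeomorph.isClosedEmbedding.polishSpace

variable [MeasurableSpace k] [BorelSpace k]

instance units_borelSpace : BorelSpace kˣ := by
  constructor
  rw [Units.isOpenEmbedding_val.isEmbedding.eq_induced, borel_comap, ← BorelSpace.measurable_eq]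
  rfl

end Instances

/-! ### Valuations, shells and polydiscs. -/

section Order

variable (k : Type*) [NontriviallyNormedField k] [IsUltrametricDist k] [LocallyCompactSpace k]

/-- In the ultrametric case the open unit ball is closed, hence compact, so the norm attains a
maximum on it. -/
theorem exists_uniformizer :
    ∃ p : kˣ, ‖(p : k)‖ < 1 ∧ ∀ x : k, ‖x‖ < 1 → ‖x‖ ≤ ‖(p : k)‖ := by
  have hc : IsCompact (Metric.ball (0 : k) 1) :=
    (isCompact_closedBall (0 : k) 1).of_isClosed_subset
      (IsUltrametricDist.isClosed_ball (0 : k) 1) Metric.ball_subset_closedBall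
  obtain ⟨p, hp, hmax⟩ := hc.exists_isMaxOn ⟨0, by simp⟩ continuous_norm.continuousOn
  obtain ⟨x, hx0, hx1⟩ := NormedField.exists_norm_lt_one k
  have hp0 : p ≠ 0 := by
    rintro rfl
    have := hmax (show x ∈ Metric.ball (0 : k) 1 by simpa using hx1)
    simp at this
    simp [this] at hx0
  exact ⟨Units.mk0 p hp0, by simpa using hp, fun x hx => hmax (by simpa using hx)⟩

/-- A uniformizer of `k`. -/
def unif : kˣ := (exists_uniformizer k).choose

theorem norm_unif_lt_one : ‖(unif k : k)‖ < 1 := (exists_uniformizer k).choose_spec.1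

theorem norm_unif_pos : 0 < ‖(unif k : k)‖ := norm_pos_iff.2 (unif k).ne_zero

variable {k}

theorem norm_le_norm_unif {x : k} (hx : ‖x‖ < 1) : ‖x‖ ≤ ‖(unif k : k)‖ :=
  (exists_uniformizer k).choose_spec.2 x hx

/-- Dividing by a power of the uniformizer brings the norm into $(|\varpi|,1]$; no norm lies
strictly between $|\varpi|$ and $1$, so the quotient has norm $1$. -/
theorem exists_norm_eq_zpow (x : kˣ) : ∃ m : ℤ, ‖(x : k)‖ = ‖(unif k : k)‖ ^ m := by
  have h0 := norm_unif_pos k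
  have h1 := norm_unif_lt_one k
  have hx : 0 < ‖(x : k)‖ := norm_pos_iff.2 x.ne_zero
  obtain ⟨m, hm1, hm2⟩ := exists_mem_Ioc_zpow hx ((one_lt_inv₀ h0).2 h1)
  refine ⟨-m - 1, ?_⟩
  simp only [inv_zpow', neg_add_rev] at hm1 hm2
  have hy : ‖(x : k) * ((unif k : k) ^ (-m - 1))⁻¹‖ = ‖(x : k)‖ * (‖(unif k : k)‖ ^ (-m - 1))⁻¹ := by
    simp
  have hpos : 0 < ‖(unif k : k)‖ ^ (-m - 1) := zpow_pos h0 _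
  have e : -1 + -m = -m - 1 := by ring
  rw [e] at hm2
  have hle : ‖(x : k) * ((unif k : k) ^ (-m - 1))⁻¹‖ ≤ 1 := by
    rw [hy, ← div_eq_mul_inv, div_le_one hpos]; exact hm2
  have hlt : ‖(unif k : k)‖ < ‖(x : k) * ((unif k : k) ^ (-m - 1))⁻¹‖ := by
    rw [hy, ← div_eq_mul_inv, lt_div_iff₀ hpos, ← zpow_one_add₀ h0.ne']
    have : (1 + (-m - 1)) = -m := by ring
    rwa [this]
  have heq : ‖(x : k) * ((unif k : k) ^ (-m - 1))⁻¹‖ = 1 := by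
    refine le_antisymm hle (not_lt.1 fun h => ?_)
    exact absurd (norm_le_norm_unif h) (not_le.2 hlt)
  rw [hy, ← div_eq_mul_inv, div_eq_one_iff_eq hpos.ne'] at heq
  exact heq

/-- The additive valuation of `k^×`. -/
def ord (x : kˣ) : ℤ := (exists_norm_eq_zpow x).choose

theorem norm_eq_zpow_ord (x : kˣ) : ‖(x : k)‖ = ‖(unif k : k)‖ ^ ord x :=
  (exists_norm_eq_zpow x).choose_spec

theorem zpow_unif_le_iff {a b : ℤ} : ‖(unif k : k)‖ ^ a ≤ ‖(unif k : k)‖ ^ b ↔ b ≤ a :=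
  zpow_le_zpow_iff_right_of_lt_one₀ (norm_unif_pos k) (norm_unif_lt_one k)

theorem zpow_unif_lt_iff {a b : ℤ} : ‖(unif k : k)‖ ^ a < ‖(unif k : k)‖ ^ b ↔ b < a :=
  zpow_lt_zpow_iff_right_of_lt_one₀ (norm_unif_pos k) (norm_unif_lt_one k)

theorem zpow_unif_inj {a b : ℤ} : ‖(unif k : k)‖ ^ a = ‖(unif k : k)‖ ^ b ↔ a = b := by
  constructor
  · intro h
    exact le_antisymm (zpow_unif_le_iff.1 h.ge) (zpow_unif_le_iff.1 h.le)
  · rintro rfl; rfl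

theorem ord_eq_iff {x : kˣ} {m : ℤ} : ord x = m ↔ ‖(x : k)‖ = ‖(unif k : k)‖ ^ m := by
  rw [norm_eq_zpow_ord, zpow_unif_inj]

theorem ord_eq_zero_iff {x : kˣ} : ord x = 0 ↔ ‖(x : k)‖ = 1 := by
  rw [ord_eq_iff, zpow_zero]

@[simp] theorem ord_mul (x y : kˣ) : ord (x * y) = ord x + ord y := by
  rw [ord_eq_iff, zpow_add₀ (norm_unif_pos k).ne', ← norm_eq_zpow_ord, ← norm_eq_zpow_ord]
  simp

@[simp] theorem ord_one : ord (1 : kˣ) = 0 := by rw [ord_eq_zero_iff]; simp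

@[simp] theorem ord_inv (x : kˣ) : ord x⁻¹ = -ord x := by
  have := ord_mul x x⁻¹
  simp at this
  omega

@[simp] theorem ord_unif : ord (unif k) = 1 := by rw [ord_eq_iff, zpow_one]

/-- `ord` as a homomorphism. -/
def ordHom : kˣ →* Multiplicative ℤ where
  toFun x := Multiplicative.ofAdd (ord x)
  map_one' := by simp
  map_mul' x y := by simp

@[simp] theorem ord_zpow (x : kˣ) (m : ℤ) : ord (x ^ m) = m * ord x := by
  have h := map_zpow (ordHom (k := k)) x m
  have h2 := congrArg Multiplicative.toAdd h
  simpa [ordHom] using h2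

theorem ord_prod {ι : Type*} (s : Finset ι) (x : ι → kˣ) : ord (∏ i ∈ s, x i) = ∑ i ∈ s, ord (x i) := by
  classical
  induction s using Finset.induction_on with
  | empty => simp
  | insert a s ha ih => rw [Finset.prod_insert ha, Finset.sum_insert ha, ord_mul, ih]

theorem continuous_ord : Continuous (ord : kˣ → ℤ) := by
  refine continuous_discrete_rng.2 fun m => ?_
  have : (ord : kˣ → ℤ) ⁻¹' {m} = Units.val ⁻¹' (Metric.sphere (0 : k) (‖(unif k : k)‖ ^ m)) := by
    ext x
    simp [ord_eq_iff]
  rw [this]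
  exact (IsUltrametricDist.isOpen_sphere _ (zpow_pos (norm_unif_pos k) _).ne').preimage
    Units.continuous_val

theorem isCompact_units_annulus {a b : ℝ} (ha : 0 < a) :
    IsCompact {x : kˣ | a ≤ ‖(x : k)‖ ∧ ‖(x : k)‖ ≤ b} := by
  have hK : IsCompact {x : k | a ≤ ‖x‖ ∧ ‖x‖ ≤ b} := by
    refine (isCompact_closedBall (0 : k) b).of_isClosed_subset ?_ ?_
    · exact (isClosed_le continuous_const continuous_norm).inter
        (isClosed_le continuous_norm continuous_const)
    · intro x hx; simpa using hx.2
  refine (Units.isOpenEmbedding_val (R := k)).isEmbedding.isInducing.isCompact_preimage' hK ?_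
  intro x hx
  have : x ≠ 0 := norm_pos_iff.1 (ha.trans_le hx.1)
  exact ⟨Units.mk0 x this, rfl⟩

variable {n : ℕ}

/-- The vector of valuations of a point of `T_n(k)`. -/
def ordVec (x : Fin n → kˣ) : Fin n → ℤ := fun i => ord (x i)

@[simp] theorem ordVec_apply (x : Fin n → kˣ) (i : Fin n) : ordVec x i = ord (x i) := rfl

theorem ordVec_mul (x y : Fin n → kˣ) : ordVec (x * y) = ordVec x + ordVec y := by
  ext i; simp

@[simp] theorem ordVec_one : ordVec (1 : Fin n → kˣ) = 0 := by
  ext i; simp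

@[simp] theorem ordVec_inv (x : Fin n → kˣ) : ordVec x⁻¹ = -ordVec x := by
  ext i; simp

theorem continuous_ordVec : Continuous (ordVec : (Fin n → kˣ) → Fin n → ℤ) :=
  continuous_pi fun i => continuous_ord.comp (continuous_apply i)

variable (k) in
/-- The points of `T_n(k)` with a given vector of valuations. -/
def shell (v : Fin n → ℤ) : Set (Fin n → kˣ) := {x | ordVec x = v}

theorem mem_shell {v : Fin n → ℤ} {x : Fin n → kˣ} : x ∈ shell k v ↔ ordVec x = v := Iff.rfl

theorem isOpen_shell (v : Fin n → ℤ) : IsOpen (shell k v) :=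
  (isOpen_discrete {v}).preimage continuous_ordVec

theorem isCompact_shell (v : Fin n → ℤ) : IsCompact (shell k v) := by
  have : shell k v = Set.pi Set.univ fun i =>
      {x : kˣ | ‖(unif k : k)‖ ^ v i ≤ ‖(x : k)‖ ∧ ‖(x : k)‖ ≤ ‖(unif k : k)‖ ^ v i} := by
    ext x
    rw [mem_shell, funext_iff]
    simp only [ordVec_apply, Set.mem_pi, Set.mem_univ, true_imp_iff]
    refine forall_congr' fun i => ?_
    rw [ord_eq_iff, le_antisymm_iff, and_comm]
    rfl
  rw [this]
  exact isCompact_univ_pi fun i => isCompact_units_annulus (zpow_pos (norm_unif_pos k) _)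

theorem iUnion_shell : ⋃ v, shell k (n := n) v = Set.univ := by
  ext x; simp [mem_shell]

theorem pairwise_disjoint_shell : Pairwise (Function.onFun Disjoint (shell k (n := n))) := by
  intro v w h
  refine Set.disjoint_left.2 fun x hx hy => h ?_
  rw [mem_shell] at hx hy
  rw [← hx, hy]

variable [MeasurableSpace k] [BorelSpace k]

theorem measurableSet_shell (v : Fin n → ℤ) : MeasurableSet (shell k v) :=
  (isOpen_shell v).measurableSet

/-- The points of `T_n(k)` with coordinates of norm at most `R`. -/
def polydisc (R : ℝ) : Set (Fin n → kˣ) := {x | ∀ i, ‖(x i : k)‖ ≤ R}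

theorem measurableSet_polydisc (R : ℝ) : MeasurableSet (polydisc R : Set (Fin n → kˣ)) := by
  refine IsClosed.measurableSet ?_
  simp only [polydisc, Set.ofPred_forall]
  exact isClosed_iInter fun i => isClosed_le
    ((Units.continuous_val.comp (continuous_apply i)).norm) continuous_const

end Order

/-! ### The fibre measures as a measurable kernel, and disintegration of the Haar measure of
$T_n(k)$. -/

section Kernel

variable {k : Type*} [NontriviallyNormedField k] [IsUltrametricDist k] [LocallyCompactSpace k]
variable {n r : ℕ} (w : Fin n → Fin r → ℤ)

theorem continuous_dualMap : Continuous (dualMap (k := k) w) := by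
  refine continuous_pi fun j => ?_
  change Continuous fun x : Fin n → kˣ => ∏ i, x i ^ w i j
  exact continuous_finsetProd _ fun i _ => (continuous_apply i).zpow _

theorem isClosed_ker_dualMap : IsClosed ((dualMap (k := k) w).ker : Set (Fin n → kˣ)) := by
  have : ((dualMap (k := k) w).ker : Set (Fin n → kˣ)) = dualMap (k := k) w ⁻¹' {1} := by
    ext x; simp [MonoidHom.mem_ker]
  rw [this]
  exact isClosed_singleton.preimage (continuous_dualMap w)

theorem isClosedEmbedding_ker :
    IsClosedEmbedding (Subtype.val : (dualMap (k := k) w).ker → (Fin n → kˣ)) :=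
  (isClosed_ker_dualMap w).isClosedEmbedding_subtypeVal

instance locallyCompact_ker : LocallyCompactSpace (dualMap (k := k) w).ker :=
  (isClosedEmbedding_ker w).locallyCompactSpace

instance secondCountable_ker : SecondCountableTopology (dualMap (k := k) w).ker :=
  (isClosedEmbedding_ker w).isEmbedding.secondCountableTopology

instance sigmaCompact_ker : SigmaCompactSpace (dualMap (k := k) w).ker :=
  (isClosedEmbedding_ker w).sigmaCompactSpace

variable [MeasurableSpace k] [BorelSpace k]

theorem measurable_dualMap : Measurable (dualMap (k := k) w) := (continuous_dualMap w).measurable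

theorem measurableSet_range_dualMap : MeasurableSet (Set.range (dualMap (k := k) w)) := by
  obtain ⟨K, hK, h⟩ := isSigmaCompact_range (continuous_dualMap (k := k) w)
  rw [← h]
  exact MeasurableSet.iUnion fun i => (hK i).measurableSet

variable (mU : Measure (dualMap (k := k) w).ker)

theorem fibreMeasure_of_notMem {t : Fin r → kˣ} (ht : t ∉ Set.range (dualMap (k := k) w)) :
    fibreMeasure w mU t = 0 := by
  rw [fibreMeasure, dif_neg]
  exact ht

variable [mU.IsHaarMeasure]

/-- Two points of a fibre differ by an element of the kernel, which the invariance of `mU` absorbs;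
the chosen base point can thus be replaced by any other. -/
theorem fibreMeasure_dualMap (y : Fin n → kˣ) :
    fibreMeasure w mU (dualMap w y) = mU.map (fun u : (dualMap (k := k) w).ker => (u : Fin n → kˣ) * y) := by
  have h : ∃ x : Fin n → kˣ, dualMap w x = dualMap w y := ⟨y, rfl⟩
  rw [fibreMeasure, dif_pos h]
  set x := h.choose with hx
  have hxy : dualMap w x = dualMap w y := h.choose_spec
  let u₀ : (dualMap (k := k) w).ker := ⟨x * y⁻¹, by rw [MonoidHom.mem_ker]; simp [hxy]⟩
  have e : (fun u : (dualMap (k := k) w).ker => (u : Fin n → kˣ) * x) =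
      (fun u : (dualMap (k := k) w).ker => (u : Fin n → kˣ) * y) ∘ (fun u => u * u₀) := by
    funext u
    simp [u₀, mul_assoc]
  rw [e, ← Measure.map_map (by fun_prop) (by fun_prop), map_mul_right_eq_self]

theorem fibreMeasure_dualMap_apply (y : Fin n → kˣ) {E : Set (Fin n → kˣ)} (hE : MeasurableSet E) :
    fibreMeasure w mU (dualMap w y) E = mU {u | (u : Fin n → kˣ) * y ∈ E} := by
  rw [fibreMeasure_dualMap, Measure.map_apply (by fun_prop) hE]
  rfl

theorem measurable_fibreMeasure : Measurable (fibreMeasure w mU) := by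
  refine Measure.measurable_of_measurable_coe _ fun E hE => ?_
  refine measurable_of_restrict_of_restrict_compl (measurableSet_range_dualMap (k := k) w) ?_ ?_
  -- Measurability on the image may be tested after pulling back to the Polish space $T_n(k)$, where
  -- the function becomes the measure of a slice of a measurable subset of a product.
  · refine (Measurable.measurable_comp_iff_restrict (measurable_dualMap w)).1 ?_
    have : (fun t => fibreMeasure w mU t E) ∘ dualMap w = fun y => mU {u | (u : Fin n → kˣ) * y ∈ E} :=
      funext fun y => fibreMeasure_dualMap_apply w mU y hE
    rw [this]
    have hm : MeasurableSet {p : (dualMap (k := k) w).ker × (Fin n → kˣ) | (p.1 : Fin n → kˣ) * p.2 ∈ E} :=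
      (show Measurable fun p : (dualMap (k := k) w).ker × (Fin n → kˣ) => (p.1 : Fin n → kˣ) * p.2
        by fun_prop) hE
    exact measurable_measure_prodMk_right hm
  · have : Set.domRestrict (Set.range (dualMap (k := k) w))ᶜ (fun t => fibreMeasure w mU t E) = fun _ => 0 := by
      funext t
      simp [fibreMeasure_of_notMem w mU t.2]
    rw [this]
    exact measurable_const

/-- The fibre measures as a kernel from `T(k)` to `T_n(k)`. -/
def fibreKernel : ProbabilityTheory.Kernel (Fin r → kˣ) (Fin n → kˣ) :=
  ⟨fibreMeasure w mU, measurable_fibreMeasure w mU⟩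

theorem fibreKernel_apply (t : Fin r → kˣ) : fibreKernel w mU t = fibreMeasure w mU t := rfl

theorem fibreMeasure_lt_top_of_isCompact (t : Fin r → kˣ) {C : Set (Fin n → kˣ)} (hC : IsCompact C) :
    fibreMeasure w mU t C < ⊤ := by
  by_cases ht : t ∈ Set.range (dualMap (k := k) w)
  · obtain ⟨y, rfl⟩ := ht
    rw [fibreMeasure_dualMap_apply w mU y hC.measurableSet]
    have : {u : (dualMap (k := k) w).ker | (u : Fin n → kˣ) * y ∈ C} =
        (Subtype.val : (dualMap (k := k) w).ker → (Fin n → kˣ)) ⁻¹' ((Homeomorph.mulRight y) ⁻¹' C) := by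
      ext u; simp
    rw [this]
    refine IsCompact.measure_lt_top ((isClosedEmbedding_ker w).isCompact_preimage ?_)
    exact (Homeomorph.mulRight y).isClosedEmbedding.isCompact_preimage hC
  · simp [fibreMeasure_of_notMem w mU ht]

theorem ae_fibreMeasure (t : Fin r → kˣ) : ∀ᵐ x ∂(fibreMeasure w mU t), dualMap w x = t := by
  by_cases ht : t ∈ Set.range (dualMap (k := k) w)
  · obtain ⟨y, rfl⟩ := ht
    rw [fibreMeasure_dualMap]
    refine (ae_map_iff (by fun_prop) ?_).2 (ae_of_all _ fun u => ?_)
    · exact (measurable_dualMap w) (measurableSet_singleton _)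
    · have := u.2
      rw [MonoidHom.mem_ker] at this
      simp [this]
  · simp [fibreMeasure_of_notMem w mU ht]

theorem fibreMeasure_ne_zero (y : Fin n → kˣ) : fibreMeasure w mU (dualMap w y) ≠ 0 := by
  intro h
  have := fibreMeasure_dualMap_apply w mU y MeasurableSet.univ
  rw [h] at this
  simp at this
  exact NeZero.ne mU (Measure.measure_univ_eq_zero.1 this.symm)

theorem integral_fibreMeasure (y : Fin n → kˣ) {f : (Fin n → kˣ) → ℂ} (hf : Measurable f) :
    ∫ x, f x ∂(fibreMeasure w mU (dualMap w y)) = ∫ u, f ((u : Fin n → kˣ) * y) ∂mU := by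
  rw [fibreMeasure_dualMap, integral_map (by fun_prop) hf.aestronglyMeasurable]

instance totallyDisconnected_units : TotallyDisconnectedSpace kˣ :=
  ⟨(Units.isOpenEmbedding_val (R := k)).isEmbedding.isTotallyDisconnected_range.1
    (isTotallyDisconnected_of_totallyDisconnectedSpace _) |>.1⟩

/-- The compact open subsets of a space. -/
def compactOpens (X : Type*) [TopologicalSpace X] : Set (Set X) := {C | IsCompact C ∧ IsOpen C}

theorem borel_eq_generateFrom_compactOpens :
    borel (Fin n → kˣ) = MeasurableSpace.generateFrom (compactOpens (Fin n → kˣ)) := by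
  refine (TopologicalSpace.isTopologicalBasis_of_isOpen_of_nhds (fun C hC => hC.2) ?_).borel_eq_generateFrom
  intro x O hx hO
  obtain ⟨C, hC, hxC, hCO⟩ := (loc_compact_Haus_tot_disc_of_zero_dim (H := Fin n → kˣ)).exists_subset_of_mem_open
    (show x ∈ O ∩ shell k (ordVec x) from ⟨hx, rfl⟩) (hO.inter (isOpen_shell _))
  refine ⟨C, ⟨(isCompact_shell (ordVec x)).of_isClosed_subset hC.1 (hCO.trans Set.inter_subset_right),
    hC.2⟩, hxC, hCO.trans Set.inter_subset_left⟩

/-- The quotient condition is stated for continuous compactly supported functions, in particular for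
indicators of compact open sets. These form a π-system generating the Borel sets, and the shells
exhaust the space by sets of finite measure, so the measures agree. All later integrations over `mT`
go through this equality. -/
theorem bind_fibreMeasure (mn : Measure (Fin n → kˣ)) [mn.IsHaarMeasure]
    (mT : Measure (Fin r → kˣ)) (hT : IsQuotientMeasure w mn mU mT) :
    mT.bind (fibreKernel w mU) = mn := by
  have key : ∀ C ∈ compactOpens (Fin n → kˣ), mT.bind (fibreKernel w mU) C = mn C := by
    rintro C ⟨hC, hCo⟩
    rw [Measure.bind_apply hC.measurableSet (fibreKernel w mU).measurable.aemeasurable]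
    simp_rw [fibreKernel_apply]
    rcases C.eq_empty_or_nonempty with rfl | hne
    · simp
    have hcl : IsClopen C := ⟨hC.isClosed, hCo⟩
    have hf := hT (C.indicator fun _ => 1) (hcl.continuous_indicator continuous_const)
      (HasCompactSupport.intro hC fun x hx => by simp [hx])
    have e1 : ∀ t, pushforward w mU (C.indicator fun _ => (1 : ℂ)) t =
        ((fibreMeasure w mU t C).toReal : ℂ) := by
      intro t
      rw [pushforward, integral_indicator hC.measurableSet]
      simp [Measure.real]
    simp_rw [e1] at hf
    rw [integral_complex_ofReal, integral_indicator hC.measurableSet] at hf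
    simp only [integral_const, measureReal_restrict_apply_univ, Complex.real_smul, mul_one,
      Complex.ofReal_inj] at hf
    have hpos : 0 < mn.real C := by
      rw [Measure.real, ENNReal.toReal_pos_iff]
      exact ⟨hCo.measure_pos mn hne, hC.measure_lt_top⟩
    have hm : Measurable fun t => fibreMeasure w mU t C :=
      (Measure.measurable_coe hC.measurableSet).comp (measurable_fibreMeasure w mU)
    -- The integral of a non-integrable function is $0$ by convention, whereas here it equals the
    -- positive number `mn.real C`.
    have hint : Integrable (fun t => (fibreMeasure w mU t C).toReal) mT := by
      by_contra h
      rw [integral_undef h] at hf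
      exact hpos.ne hf
    have h2 := ofReal_integral_eq_lintegral_ofReal hint (ae_of_all _ fun t => ENNReal.toReal_nonneg)
    have e2 : ∀ t, ENNReal.ofReal (fibreMeasure w mU t C).toReal = fibreMeasure w mU t C :=
      fun t => ENNReal.ofReal_toReal (fibreMeasure_lt_top_of_isCompact w mU t hC).ne
    simp_rw [e2] at h2
    rw [← h2, hf, Measure.real, ENNReal.ofReal_toReal hC.measure_lt_top.ne]
  obtain ⟨e, he⟩ := exists_surjective_nat (Fin n → ℤ)
  refine Measure.ext_of_generateFrom_of_iUnion (compactOpens (Fin n → kˣ)) (fun i => shell k (e i)) ?_ ?_ ?_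
    ?_ ?_ key
  · rw [← borel_eq_generateFrom_compactOpens]
    exact BorelSpace.measurable_eq
  · rintro A ⟨hA, hA'⟩ B ⟨hB, hB'⟩ -
    exact ⟨hA.inter_right hB.isClosed, hA'.inter hB'⟩
  · rw [he.iUnion_comp (fun v => shell k v)]
    exact iUnion_shell
  · exact fun i => ⟨isCompact_shell _, isOpen_shell _⟩
  · intro i
    rw [key _ ⟨isCompact_shell _, isOpen_shell _⟩]
    exact (isCompact_shell _).measure_lt_top.ne

section Quotient

variable {mn : Measure (Fin n → kˣ)} [mn.IsHaarMeasure] {mT : Measure (Fin r → kˣ)}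

/-- For almost every $t$ the property holds at almost every point of the fibre; a nonempty fibre has
nonzero measure, so it contains such a point, and the property depends on $t$ alone. -/
theorem ae_of_ae_dualMap (hT : IsQuotientMeasure w mn mU mT) {P : (Fin r → kˣ) → Prop}
    (hP : ∀ᵐ x ∂mn, P (dualMap w x)) (hP' : ∀ t, t ∉ Set.range (dualMap (k := k) w) → P t) :
    ∀ᵐ t ∂mT, P t := by
  rw [← bind_fibreMeasure w mU mn mT hT] at hP
  have h := Measure.ae_ae_of_ae_bind (fibreKernel w mU).measurable.aemeasurable hP
  filter_upwards [h] with t ht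
  by_cases hr : t ∈ Set.range (dualMap (k := k) w)
  · obtain ⟨y, rfl⟩ := hr
    rw [fibreKernel_apply] at ht
    have := fibreMeasure_ne_zero w mU y
    have hne : (ae (fibreMeasure w mU (dualMap w y))).NeBot := ae_neBot.2 this
    obtain ⟨x, hx1, hx2⟩ := (ht.and (ae_fibreMeasure w mU (dualMap w y))).exists
    rwa [hx2] at hx1
  · exact hP' t hr

theorem integral_fibre (hT : IsQuotientMeasure w mn mU mT) {F : (Fin n → kˣ) → ℂ}
    (hF : Integrable F mn) :
    Integrable (fun t => ∫ x, F x ∂(fibreMeasure w mU t)) mT ∧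
      ∫ t, ∫ x, F x ∂(fibreMeasure w mU t) ∂mT = ∫ x, F x ∂mn := by
  have hb := bind_fibreMeasure w mU mn mT hT
  rw [Measure.comp_eq_comp_const_apply] at hb
  rw [← hb] at hF
  have h1 := hF.integral_comp
  have h2 := ProbabilityTheory.Kernel.integral_comp hF
  rw [hb] at h2
  simp only [ProbabilityTheory.Kernel.const_apply] at h1 h2
  exact ⟨h1, h2.symm⟩

/-- Integrating a function on `T(k)` against a push-forward is integrating its pull-back to
`T_n(k)`. -/
theorem integral_mul_pushforward (hT : IsQuotientMeasure w mn mU mT) {g : (Fin r → kˣ) → ℂ}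
    {f : (Fin n → kˣ) → ℂ} (hF : Integrable (fun x => g (dualMap w x) * f x) mn) :
    Integrable (fun t => g t * pushforward w mU f t) mT ∧
      ∫ t, g t * pushforward w mU f t ∂mT = ∫ x, g (dualMap w x) * f x ∂mn := by
  have e : ∀ t, g t * pushforward w mU f t =
      ∫ x, g (dualMap w x) * f x ∂(fibreMeasure w mU t) := by
    intro t
    rw [pushforward, ← integral_const_mul]
    refine integral_congr_ae ?_
    filter_upwards [ae_fibreMeasure w mU t] with x hx
    rw [hx]
  simp_rw [e]
  exact integral_fibre w mU hT hF

end Quotient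

end Kernel

/-! ### The module of $k^\times$, and $d^+x$ as a restricted additive Haar measure. -/

section Additive

open scoped NNReal ENNReal Pointwise

variable {k : Type*} [NontriviallyNormedField k] [IsUltrametricDist k] [LocallyCompactSpace k]

theorem distribHaarChar_of_ord_eq_zero {x : kˣ} (hx : ord x = 0) : distribHaarChar k x = 1 := by
  borelize k
  have hx1 : ‖(x : k)‖ = 1 := ord_eq_zero_iff.1 hx
  have hs : x • Metric.closedBall (0 : k) 1 = Metric.closedBall (0 : k) 1 := by
    ext y
    rw [Set.mem_smul_set_iff_inv_smul_mem]
    simp [Units.smul_def, hx1]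
  refine distribHaarChar_eq_of_measure_smul_eq_mul (μ := (Measure.addHaar : Measure k))
    (s := Metric.closedBall 0 1) ?_ ?_ ?_
  · exact (Metric.measure_closedBall_pos _ _ one_pos).ne'
  · exact measure_closedBall_lt_top.ne
  · rw [hs]; simp

variable (k) in
/-- The inverse of the cardinality of the residue field, as the module of a uniformizer. -/
def unifAbs : ℝ≥0 := distribHaarChar k (unif k)

theorem unifAbs_pos : 0 < unifAbs k := distribHaarChar_pos

/-- Multiplication by the uniformizer sends the closed unit ball into the open one, and the unit
sphere that is lost is open, hence of positive measure. -/
theorem unifAbs_lt_one : unifAbs k < 1 := by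
  borelize k
  set μ : Measure k := Measure.addHaar
  have h := distribHaarChar_mul μ (unif k) (Metric.closedBall (0 : k) 1)
  have hsub : unif k • Metric.closedBall (0 : k) 1 ⊆ Metric.ball (0 : k) 1 := by
    rintro _ ⟨y, hy, rfl⟩
    simp only [Metric.mem_closedBall, dist_zero_right] at hy
    simp only [Metric.mem_ball, dist_zero_right, norm_smul]
    calc ‖(unif k : k)‖ * ‖y‖ ≤ ‖(unif k : k)‖ * 1 := by gcongr
      _ < 1 := by rw [mul_one]; exact norm_unif_lt_one k
  have hu : Metric.closedBall (0 : k) 1 = Metric.ball 0 1 ∪ Metric.sphere 0 1 :=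
    Metric.ball_union_sphere.symm
  have hsp : 0 < μ (Metric.sphere (0 : k) 1) :=
    (IsUltrametricDist.isOpen_sphere (0 : k) one_ne_zero).measure_pos μ ⟨1, by simp⟩
  have hlt : μ (Metric.ball (0 : k) 1) < μ (Metric.closedBall (0 : k) 1) := by
    rw [hu, measure_union Metric.sphere_disjoint_ball.symm Metric.isClosed_sphere.measurableSet]
    exact ENNReal.lt_add_right measure_ball_lt_top.ne hsp.ne'
  have h2 : (unifAbs k : ℝ≥0∞) * μ (Metric.closedBall (0 : k) 1) < 1 * μ (Metric.closedBall (0 : k) 1) := by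
    rw [one_mul]
    change (distribHaarChar k (unif k) : ℝ≥0∞) * _ < _
    rw [h]
    exact (measure_mono hsub).trans_lt hlt
  have h3 := lt_of_mul_lt_mul_right' h2
  exact_mod_cast h3

theorem distribHaarChar_eq_zpow (x : kˣ) : distribHaarChar k x = unifAbs k ^ ord x := by
  have h : ord (x * (unif k ^ ord x)⁻¹) = 0 := by simp
  have h2 := distribHaarChar_of_ord_eq_zero h
  rw [map_mul, map_inv, map_zpow, show distribHaarChar k (unif k) = unifAbs k from rfl, mul_inv_eq_one₀ (zpow_ne_zero _ unifAbs_pos.ne')] at h2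
  exact h2

variable {n : ℕ}

/-- The module of the product of the coordinates. -/
def prodAbs (x : Fin n → kˣ) : ℝ≥0 := distribHaarChar k (∏ i, x i)

theorem prodAbs_eq_zpow (x : Fin n → kˣ) : prodAbs x = unifAbs k ^ (∑ i, ord (x i)) := by
  rw [prodAbs, distribHaarChar_eq_zpow, ord_prod]

theorem normAbs_prod (x : Fin n → kˣ) : normAbs (∏ i, x i) = prodAbs x := rfl

theorem prodAbs_mul (x y : Fin n → kˣ) : prodAbs (x * y) = prodAbs x * prodAbs y := by
  simp [prodAbs, Finset.prod_mul_distrib]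

theorem prodAbs_pos (x : Fin n → kˣ) : 0 < prodAbs x := distribHaarChar_pos

theorem continuous_prodAbs : Continuous (prodAbs : (Fin n → kˣ) → ℝ≥0) := by
  have : (prodAbs : (Fin n → kˣ) → ℝ≥0) = (fun v : Fin n → ℤ => unifAbs k ^ (∑ i, v i)) ∘ ordVec := by
    funext x; rw [prodAbs_eq_zpow]; rfl
  rw [this]
  exact continuous_of_discreteTopology.comp continuous_ordVec

/-- The inclusion of `T_n(k)` in `k^n`. -/
def coords (x : Fin n → kˣ) : Fin n → k := fun i => x i

theorem isOpenEmbedding_coords : IsOpenEmbedding (coords : (Fin n → kˣ) → Fin n → k) :=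
  ⟨Topology.IsEmbedding.piMap fun _ => Units.isOpenEmbedding_val.isEmbedding, by
    have : Set.range (coords : (Fin n → kˣ) → Fin n → k) = Set.pi Set.univ fun _ => {x : k | x ≠ 0} := by
      ext z
      constructor
      · rintro ⟨x, rfl⟩ i -
        exact (x i).ne_zero
      · intro h
        exact ⟨fun i => Units.mk0 (z i) (h i trivial), rfl⟩
    rw [this]
    exact isOpen_set_pi Set.finite_univ fun i _ => isOpen_ne⟩

theorem notMem_range_coords {z : Fin n → k} (hz : z ∉ Set.range (coords : (Fin n → kˣ) → Fin n → k)) :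
    ∃ i, z i = 0 := by
  by_contra! h
  exact hz ⟨fun i => Units.mk0 (z i) (h i), rfl⟩

variable [MeasurableSpace k] [BorelSpace k]

theorem measurableEmbedding_coords : MeasurableEmbedding (coords : (Fin n → kˣ) → Fin n → k) :=
  isOpenEmbedding_coords.measurableEmbedding

theorem measurable_prodAbs : Measurable (prodAbs : (Fin n → kˣ) → ℝ≥0) :=
  continuous_prodAbs.measurable

variable (k n) in
/-- A Haar measure of `k^n`. -/
def addMeasure : Measure (Fin n → k) := Measure.pi fun _ => (Measure.addHaar : Measure k)

instance : (addMeasure k n).IsAddHaarMeasure := by unfold addMeasure; infer_instance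

theorem map_smul_addHaar (g : kˣ) : (Measure.addHaar : Measure k).map (fun z => (g : k) * z) =
    ((distribHaarChar k g)⁻¹ : ℝ≥0) • (Measure.addHaar : Measure k) := by
  ext s hs
  rw [Measure.map_apply (by fun_prop) hs, Measure.smul_apply, ← map_inv, ENNReal.smul_def, smul_eq_mul,
    distribHaarChar_mul]
  congr 1
  ext z
  rw [Set.mem_smul_set_iff_inv_smul_mem, inv_inv]
  rfl

/-- A diagonal scaling acts coordinate by coordinate, so its module is the product of the modules of
the entries. -/
theorem map_mul_addMeasure (g : Fin n → kˣ) :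
    (addMeasure k n).map (fun z i => (g i : k) * z i) = ((prodAbs g)⁻¹ : ℝ≥0) • addMeasure k n := by
  have : ∀ i, SigmaFinite ((Measure.addHaar : Measure k).map (fun z => (g i : k) * z)) := by
    intro i
    rw [map_smul_addHaar]
    infer_instance
  unfold addMeasure
  rw [Measure.pi_map_pi (μ := fun _ => (Measure.addHaar : Measure k)) (f := fun i z => (g i : k) * z)
    (fun i => by fun_prop)]
  refine Measure.pi_eq fun s hs => ?_
  rw [Measure.smul_apply, Measure.pi_pi]
  simp_rw [map_smul_addHaar, Measure.smul_apply, ENNReal.smul_def, smul_eq_mul]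
  rw [Finset.prod_mul_distrib, prodAbs, map_prod, ← Finset.prod_inv_distrib]
  push_cast
  rfl

theorem addMeasure_compl_range :
    addMeasure k n (Set.range (coords : (Fin n → kˣ) → Fin n → k))ᶜ = 0 := by
  have hsub : (Set.range (coords : (Fin n → kˣ) → Fin n → k))ᶜ ⊆
      ⋃ i, {z : Fin n → k | z i = 0} := by
    intro z hz
    simpa using notMem_range_coords hz
  refine measure_mono_null hsub (measure_iUnion_null fun i => ?_)
  exact Measure.pi_hyperplane (fun _ => (Measure.addHaar : Measure k)) i 0

variable (k n) in
/-- The restriction of the Haar measure of `k^n` to `T_n(k)`. -/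
def addMeasureUnits : Measure (Fin n → kˣ) :=
  (addMeasure k n).comap coords

theorem map_coords_addMeasureUnits : (addMeasureUnits k n).map coords = addMeasure k n := by
  rw [addMeasureUnits, measurableEmbedding_coords.map_comap, Measure.restrict_eq_self_of_ae_mem]
  exact addMeasure_compl_range

theorem map_mul_addMeasureUnits (g : Fin n → kˣ) :
    (addMeasureUnits k n).map (fun x => g * x) = ((prodAbs g)⁻¹ : ℝ≥0) • addMeasureUnits k n := by
  have h : ((addMeasureUnits k n).map (fun x => g * x)).map coords =
      (((prodAbs g)⁻¹ : ℝ≥0) • addMeasureUnits k n).map coords := by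
    rw [Measure.map_map measurableEmbedding_coords.measurable (by fun_prop), Measure.map_smul,
      map_coords_addMeasureUnits, ← map_mul_addMeasure, ← map_coords_addMeasureUnits,
      Measure.map_map (by fun_prop) measurableEmbedding_coords.measurable]
    rfl
  have := congrArg (fun μ => μ.comap coords) h
  simp only [measurableEmbedding_coords.comap_map] at this
  exact this

variable (k n) in
/-- The multiplicative Haar measure of `T_n(k)` with density the inverse module with respect
to the Haar measure of `k^n`. -/
def mulMeasure : Measure (Fin n → kˣ) :=
  (addMeasureUnits k n).withDensity fun x => ((prodAbs x)⁻¹ : ℝ≥0)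

theorem measurable_prodAbs_inv :
    Measurable fun x : Fin n → kˣ => (((prodAbs x)⁻¹ : ℝ≥0) : ℝ≥0∞) :=
  measurable_prodAbs.inv.coe_nnreal_ennreal

instance mulMeasure_isMulLeftInvariant : (mulMeasure k n).IsMulLeftInvariant := by
  constructor
  intro g
  ext E hE
  have hgE : MeasurableSet ((fun x => g * x) ⁻¹' E) := (measurable_const_mul g) hE
  rw [Measure.map_apply (by fun_prop) hE, mulMeasure, withDensity_apply _ hgE, withDensity_apply _ hE,
    ← lintegral_indicator hgE, ← lintegral_indicator hE]
  set f : (Fin n → kˣ) → ℝ≥0∞ := E.indicator fun x => ((prodAbs x)⁻¹ : ℝ≥0) with hf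
  have hfm : Measurable f := measurable_prodAbs_inv.indicator hE
  have e : ((fun x => g * x) ⁻¹' E).indicator (fun x => (((prodAbs x)⁻¹ : ℝ≥0) : ℝ≥0∞)) =
      fun x => (prodAbs g : ℝ≥0∞) * f (g * x) := by
    funext x
    by_cases hx : g * x ∈ E
    · rw [Set.indicator_of_mem (show x ∈ (fun x => g * x) ⁻¹' E from hx), hf, Set.indicator_of_mem hx,
        ← ENNReal.coe_mul, prodAbs_mul, mul_inv, ← mul_assoc, mul_inv_cancel₀ (prodAbs_pos g).ne', one_mul]
    · rw [Set.indicator_of_notMem (show x ∉ (fun x => g * x) ⁻¹' E from hx), hf,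
        Set.indicator_of_notMem hx, mul_zero]
  have hfm2 : Measurable fun x => f (g * x) := hfm.comp (measurable_const_mul g)
  -- The factor by which the additive measure scales cancels the one by which the density scales.
  rw [e, lintegral_const_mul _ hfm2,
    ← lintegral_map hfm (measurable_const_mul g), map_mul_addMeasureUnits, lintegral_smul_measure,
    ENNReal.smul_def, smul_eq_mul, ← mul_assoc, ← ENNReal.coe_mul, mul_inv_cancel₀ (prodAbs_pos g).ne',
    ENNReal.coe_one, one_mul]

instance mulMeasure_finiteOnCompacts : IsFiniteMeasureOnCompacts (mulMeasure k n) := by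
  constructor
  intro C hC
  rw [mulMeasure, withDensity_apply _ hC.measurableSet]
  obtain ⟨B, hB⟩ := hC.bddAbove_image
    ((continuous_prodAbs (k := k) (n := n)).inv₀ fun x => (prodAbs_pos x).ne').continuousOn
  have hfin : addMeasureUnits k n C < ⊤ := by
    rw [addMeasureUnits, measurableEmbedding_coords.comap_apply]
    exact (hC.image isOpenEmbedding_coords.continuous).measure_lt_top
  calc ∫⁻ x in C, ((prodAbs x)⁻¹ : ℝ≥0) ∂(addMeasureUnits k n)
      ≤ ∫⁻ x in C, (B : ℝ≥0∞) ∂(addMeasureUnits k n) := by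
        refine setLIntegral_mono' hC.measurableSet fun x hx => ?_
        exact_mod_cast hB ⟨x, hx, rfl⟩
    _ = B * addMeasureUnits k n C := by simp
    _ < ⊤ := ENNReal.mul_lt_top ENNReal.coe_lt_top hfin

/-- The measure `d⁺x = |x_1 ⋯ x_n| dx`. -/
def plusMeasure (mn : Measure (Fin n → kˣ)) : Measure (Fin n → kˣ) :=
  mn.withDensity fun x => (prodAbs x : ℝ≥0∞)

/-- By uniqueness of Haar measure, `mulMeasure` is a multiple of `mn`; multiplying by the module
removes the density of the former. This gives access to additive translations, the source of all
cancellation below. -/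
theorem exists_map_coords_plusMeasure (mn : Measure (Fin n → kˣ)) [mn.IsHaarMeasure] :
    ∃ c : ℝ≥0, (plusMeasure mn).map coords = c • addMeasure k n := by
  have h := Measure.isMulLeftInvariant_eq_smul (mulMeasure k n) mn
  set c := Measure.haarScalarFactor (mulMeasure k n) mn
  have h2 : c • plusMeasure mn = addMeasureUnits k n := by
    have e : (mulMeasure k n).withDensity (fun x => (prodAbs x : ℝ≥0∞)) = addMeasureUnits k n := by
      rw [mulMeasure, ← withDensity_mul _ measurable_prodAbs_inv measurable_prodAbs.coe_nnreal_ennreal]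
      have : ((fun x : Fin n → kˣ => (((prodAbs x)⁻¹ : ℝ≥0) : ℝ≥0∞)) * fun x => (prodAbs x : ℝ≥0∞)) = 1 := by
        funext x
        simp only [Pi.mul_apply, Pi.one_apply]
        rw [← ENNReal.coe_mul, inv_mul_cancel₀ (prodAbs_pos x).ne', ENNReal.coe_one]
      rw [this, withDensity_one]
    rw [← e, h, plusMeasure]
    exact (withDensity_smul_measure (c : ℝ≥0∞) _).symm
  have h3 : c • (plusMeasure mn).map coords = addMeasure k n := by
    rw [← Measure.map_smul, h2, map_coords_addMeasureUnits]
  refine ⟨c⁻¹, ?_⟩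
  have hc : c ≠ 0 := by
    rintro hc
    rw [hc, zero_smul] at h3
    exact NeZero.ne (addMeasure k n) h3.symm
  rw [← h3, smul_smul, inv_mul_cancel₀ hc, one_smul]

end Additive

/-! ### Exponentially small volume of the units of $U(k)$ near $1$ in one coordinate. -/

section Decay

open scoped NNReal ENNReal

variable {k : Type*} [NontriviallyNormedField k] [IsUltrametricDist k] [LocallyCompactSpace k]

theorem norm_add_of_lt {x y : k} (h : ‖y‖ < ‖x‖) : ‖x + y‖ = ‖x‖ := by
  rw [IsUltrametricDist.norm_add_eq_max_of_norm_ne_norm h.ne', max_eq_left h.le]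

theorem norm_one_add_pow_sub_one_le {y : k} (hy : ‖y‖ ≤ 1) (N : ℕ) : ‖(1 + y) ^ N - 1‖ ≤ ‖y‖ := by
  have h1 : ‖1 + y‖ ≤ 1 := (IsUltrametricDist.norm_add_le_max _ _).trans (by simp [hy])
  rw [← geom_sum_mul, norm_mul, add_sub_cancel_left]
  refine mul_le_of_le_one_left (norm_nonneg _) ?_
  refine IsUltrametricDist.norm_sum_le_of_forall_le_of_nonneg zero_le_one fun i _ => ?_
  rw [norm_pow]
  exact pow_le_one₀ (norm_nonneg _) h1

theorem norm_natCast_le_one (N : ℕ) : ‖(N : k)‖ ≤ 1 := IsUltrametricDist.norm_natCast_le_one k N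

/-- In $(1+y)^N-1=y\sum_{i<N}(1+y)^i$ the sum differs from $N$ by an element of norm at most
$|y|<|N|$. -/
theorem norm_one_add_pow_sub_one {y : k} {N : ℕ} (hy : ‖y‖ < ‖(N : k)‖) :
    ‖(1 + y) ^ N - 1‖ = ‖(N : k)‖ * ‖y‖ := by
  have hy1 : ‖y‖ ≤ 1 := hy.le.trans (norm_natCast_le_one N)
  rw [← geom_sum_mul, norm_mul, add_sub_cancel_left]
  congr 1
  have e : ∑ i ∈ Finset.range N, (1 + y) ^ i = (N : k) + ∑ i ∈ Finset.range N, ((1 + y) ^ i - 1) := by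
    simp [Finset.sum_sub_distrib]
  rw [e]
  refine norm_add_of_lt (lt_of_le_of_lt ?_ hy)
  exact IsUltrametricDist.norm_sum_le_of_forall_le_of_nonneg (norm_nonneg _)
    fun i _ => norm_one_add_pow_sub_one_le hy1 i

variable {n r : ℕ} (w : Fin n → Fin r → ℤ)

variable (k) in
/-- The elements of the kernel `U(k)` with coordinates of norm `1`. -/
def kerUnits : Set (dualMap (k := k) w).ker := {u | ordVec (u : Fin n → kˣ) = 0}

variable (k) in
/-- The elements of the kernel `U(k)` with coordinates of norm `1`, the `i`-th one being
congruent to `1` modulo the `m`-th power of the maximal ideal. -/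
def kerUnitsNear (i : Fin n) (m : ℤ) : Set (dualMap (k := k) w).ker :=
  {u | ordVec (u : Fin n → kˣ) = 0 ∧ ‖((u : Fin n → kˣ) i : k) - 1‖ ≤ ‖(unif k : k)‖ ^ m}

theorem isOpen_kerUnits : IsOpen (kerUnits k w) :=
  (isOpen_shell 0).preimage continuous_subtype_val

theorem isCompact_kerUnits : IsCompact (kerUnits k w) :=
  (isClosedEmbedding_ker w).isCompact_preimage (isCompact_shell 0)

theorem isClosed_kerUnitsNear (i : Fin n) (m : ℤ) : IsClosed (kerUnitsNear k w i m) := by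
  refine (isCompact_kerUnits w).isClosed.inter (isClosed_le (Continuous.norm ?_) continuous_const)
  exact (Units.continuous_val.comp ((continuous_apply i).comp continuous_subtype_val)).sub
    continuous_const

theorem kerUnitsNear_subset (i : Fin n) (m : ℤ) : kerUnitsNear k w i m ⊆ kerUnits k w :=
  fun _ h => h.1

variable {w} in
/-- The point of the kernel attached to a point of `k^×` and a relation between the weights. -/
def kerPoint {l : Fin n → ℤ} (hl : ∀ j, ∑ i, l i * w i j = 0) (s : kˣ) : (dualMap (k := k) w).ker :=
  ⟨fun i => s ^ l i, by
    rw [MonoidHom.mem_ker]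
    funext j
    change ∏ i, (s ^ l i) ^ w i j = 1
    simp_rw [← zpow_mul]
    have h : ∀ (S : Finset (Fin n)) (f : Fin n → ℤ), ∏ i ∈ S, s ^ f i = s ^ ∑ i ∈ S, f i := by
      intro S f
      classical
      induction S using Finset.induction_on with
      | empty => simp
      | insert a S ha ih => rw [Finset.prod_insert ha, Finset.sum_insert ha, zpow_add, ih]
    rw [h, hl j, zpow_zero]⟩

variable [MeasurableSpace k] [BorelSpace k] (mU : Measure (dualMap (k := k) w).ker) [mU.IsHaarMeasure]

theorem kerUnits_lt_top : mU (kerUnits k w) < ⊤ := (isCompact_kerUnits w).measure_lt_top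

theorem kerUnitsNear_lt_top (i : Fin n) (m : ℤ) : mU (kerUnitsNear k w i m) < ⊤ :=
  (measure_mono (kerUnitsNear_subset w i m)).trans_lt (kerUnits_lt_top w mU)

theorem measurableSet_kerUnits : MeasurableSet (kerUnits k w) := (isOpen_kerUnits w).measurableSet

/-- The relation provides an element $g$ of $U(k)$ with unit coordinates whose $i$-th coordinate is
at distance exactly $|\varpi|^m$ from $1$. The smaller neighbourhood and its translate by $g^{-1}$
are then disjoint subsets of the larger one, of equal measure. -/
theorem two_mul_measure_kerUnitsNear_succ_le [CharZero k] {l : Fin n → ℤ}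
    (hl : ∀ j, ∑ i, l i * w i j = 0)
    {i : Fin n} {N : ℕ} (hN : N ≠ 0) (hi : l i = N) :
    ∃ m₀ : ℤ, ∀ m ≥ m₀, 2 * mU (kerUnitsNear k w i (m + 1)) ≤ mU (kerUnitsNear k w i m) := by
  have hNk : (N : k) ≠ 0 := Nat.cast_ne_zero.2 hN
  set o := ord (Units.mk0 (N : k) hNk) with ho
  have hNo : ‖(N : k)‖ = ‖(unif k : k)‖ ^ o := norm_eq_zpow_ord (Units.mk0 (N : k) hNk)
  have hp := norm_unif_pos k
  -- The element is $g=(s^{l_j})_j$ with $s=1+y$ and $y$ of valuation $m-o$; the bound on $m$ makes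
  -- $|y|<|N|$, so that $|s^N-1|=|N||y|=|\varpi|^m$.
  refine ⟨2 * o + 1, fun m hm => ?_⟩
  set y : k := (unif k : k) ^ (m - o) with hy
  have hyn : ‖y‖ = ‖(unif k : k)‖ ^ (m - o) := norm_zpow _ _
  have hyN : ‖y‖ < ‖(N : k)‖ := by
    rw [hyn, hNo, zpow_unif_lt_iff]; omega
  have hs1 : ‖1 + y‖ = 1 := by
    rw [norm_add_of_lt] <;> rw [norm_one]
    exact hyN.trans_le (norm_natCast_le_one N)
  have hs0 : 1 + y ≠ 0 := norm_pos_iff.1 (by rw [hs1]; exact one_pos)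
  set s : kˣ := Units.mk0 (1 + y) hs0 with hs
  set g := kerPoint hl s with hg
  have hgi : (((g : Fin n → kˣ) i : kˣ) : k) = (1 + y) ^ N := by
    change ((s ^ l i : kˣ) : k) = _
    rw [hi, zpow_natCast]; rfl
  have hgn : ‖(((g : Fin n → kˣ) i : kˣ) : k) - 1‖ = ‖(unif k : k)‖ ^ m := by
    rw [hgi, norm_one_add_pow_sub_one hyN, hyn, hNo, ← zpow_add₀ hp.ne']
    congr 1; ring
  have hg1 : ‖(((g : Fin n → kˣ) i : kˣ) : k)‖ = 1 := by rw [hgi, norm_pow, hs1, one_pow]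
  have hgo : ordVec (g : Fin n → kˣ) = 0 := by
    ext a
    have : ord s = 0 := ord_eq_zero_iff.2 hs1
    change ord (s ^ l a) = 0
    rw [ord_zpow, this, mul_zero]
  set A := kerUnitsNear k w i (m + 1) with hA
  have hAm : MeasurableSet A := (isClosed_kerUnitsNear w i _).measurableSet
  set B := (fun u => g * u) ⁻¹' A with hB
  have hBn : ∀ u ∈ B, ‖(((u : Fin n → kˣ) i : kˣ) : k) - 1‖ = ‖(unif k : k)‖ ^ m := by
    intro u hu
    have h2 : ‖(((g : Fin n → kˣ) i : kˣ) : k) * (((u : Fin n → kˣ) i : kˣ) : k) - 1‖ ≤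
        ‖(unif k : k)‖ ^ (m + 1) := by simpa using hu.2
    rw [← one_mul ‖(((u : Fin n → kˣ) i : kˣ) : k) - 1‖, ← hg1, ← norm_mul]
    have e : (((g : Fin n → kˣ) i : kˣ) : k) * ((((u : Fin n → kˣ) i : kˣ) : k) - 1) =
        -((((g : Fin n → kˣ) i : kˣ) : k) - 1) +
        ((((g : Fin n → kˣ) i : kˣ) : k) * (((u : Fin n → kˣ) i : kˣ) : k) - 1) := by ring
    rw [e, norm_add_of_lt] <;> rw [norm_neg, hgn]
    exact h2.trans_lt (zpow_unif_lt_iff.2 (by omega))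
  have hdisj : Disjoint A B := by
    refine Set.disjoint_left.2 fun u huA huB => ?_
    have h1 := huA.2
    rw [hBn u huB, zpow_unif_le_iff] at h1
    omega
  have hsub : A ∪ B ⊆ kerUnitsNear k w i m := by
    rintro u (hu | hu)
    · exact ⟨hu.1, hu.2.trans (zpow_unif_le_iff.2 (by omega))⟩
    · refine ⟨?_, (hBn u hu).le⟩
      have : ordVec ((g : Fin n → kˣ) * (u : Fin n → kˣ)) = 0 := hu.1
      rwa [ordVec_mul, hgo, zero_add] at this
  calc 2 * mU A = mU A + mU B := by rw [hB, measure_preimage_mul, two_mul]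
    _ = mU (A ∪ B) := (measure_union' hdisj hAm).symm
    _ ≤ _ := measure_mono hsub

theorem exists_measure_kerUnitsNear_le [CharZero k] {l : Fin n → ℤ}
    (hl : ∀ j, ∑ i, l i * w i j = 0) {i : Fin n} (hi : l i ≠ 0) :
    ∃ C : ℝ, 0 ≤ C ∧ ∀ m : ℤ, mU.real (kerUnitsNear k w i m) ≤ C * (1 / 2) ^ m := by
  wlog hpos : 0 < l i generalizing l
  · refine this (l := -l) (fun j => ?_) (by simpa using hi) ?_
    · simpa using hl j
    · simp only [Pi.neg_apply]; omega
  obtain ⟨m₀, hm₀⟩ := two_mul_measure_kerUnitsNear_succ_le w mU hl (i := i) (N := (l i).toNat)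
    (by omega) (by omega)
  have hstep : ∀ m ≥ m₀, 2 * mU.real (kerUnitsNear k w i (m + 1)) ≤ mU.real (kerUnitsNear k w i m) := by
    intro m hm
    have := ENNReal.toReal_mono (kerUnitsNear_lt_top w mU i m).ne (hm₀ m hm)
    simpa [Measure.real] using this
  set V := mU.real (kerUnits k w)
  have hle : ∀ m, mU.real (kerUnitsNear k w i m) ≤ V := fun m =>
    measureReal_mono (kerUnitsNear_subset w i m) (kerUnits_lt_top w mU).ne
  have hV : 0 ≤ V := measureReal_nonneg
  -- Below `m₀` the volume of all of `kerUnits` suffices as a bound; above `m₀` each step halves it.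
  refine ⟨V * 2 ^ m₀, by positivity, fun m => ?_⟩
  have e : V * 2 ^ m₀ * (1 / 2) ^ m = V * (1 / 2) ^ (m - m₀) := by
    rw [mul_assoc, zpow_sub₀ (by norm_num), one_div, inv_zpow, inv_zpow]
    field_simp
  rw [e]
  rcases le_total m m₀ with h | h
  · refine (hle m).trans (le_mul_of_one_le_right hV ?_)
    exact one_le_zpow_of_nonpos₀ (by norm_num) (by norm_num) (by omega)
  · obtain ⟨j, rfl⟩ := Int.le.dest h
    rw [add_sub_cancel_left, zpow_natCast]
    clear e h
    induction j with
    | zero => simpa using hle m₀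
    | succ j ih =>
      have := hstep (m₀ + j) (by omega)
      have e2 : m₀ + (j : ℤ) + 1 = m₀ + ((j + 1 : ℕ) : ℤ) := by push_cast; ring
      rw [e2] at this
      rw [pow_succ]
      linarith

end Decay

/-! ### Cancellation of additive characters over shells. -/

section Oscillation

open scoped NNReal ENNReal

variable {k : Type*} [NontriviallyNormedField k] [IsUltrametricDist k] [LocallyCompactSpace k]
variable {n r : ℕ}
variable [MeasurableSpace k] [BorelSpace k]

/-- A function on `k^n` that is multiplied by a constant different from `1` under
a translation has integral zero. -/
theorem integral_plusMeasure_eq_zero (mn : Measure (Fin n → kˣ)) [mn.IsHaarMeasure]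
    (F : (Fin n → k) → ℂ) (c : Fin n → k) {ζ : ℂ} (hζ : ζ ≠ 1) (hF : ∀ z, F (z + c) = ζ * F z) :
    ∫ x, F (coords x) ∂(plusMeasure mn) = 0 := by
  obtain ⟨a, ha⟩ := exists_map_coords_plusMeasure mn
  rw [← measurableEmbedding_coords.integral_map, ha, integral_smul_nnreal_measure]
  have h1 : ∫ z, F (z + c) ∂(addMeasure k n) = ∫ z, F z ∂(addMeasure k n) :=
    integral_add_right_eq_self F c
  simp_rw [hF] at h1
  rw [integral_const_mul] at h1
  have h2 : (ζ - 1) * ∫ z, F z ∂(addMeasure k n) = 0 := by rw [sub_mul, h1]; ring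
  rw [(mul_eq_zero.1 h2).resolve_left (sub_ne_zero.2 hζ), smul_zero]

theorem integral_plusMeasure (mn : Measure (Fin n → kˣ)) (f : (Fin n → kˣ) → ℂ) :
    ∫ x, f x ∂(plusMeasure mn) = ∫ x, (prodAbs x : ℂ) * f x ∂mn := by
  rw [plusMeasure, integral_withDensity_eq_integral_smul measurable_prodAbs]
  refine integral_congr_ae (ae_of_all _ fun x => ?_)
  simp [NNReal.smul_def]

theorem integral_shell_eq (mn : Measure (Fin n → kˣ)) (v : Fin n → ℤ) (f : (Fin n → kˣ) → ℂ) :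
    ∫ x, (shell k v).indicator f x ∂(plusMeasure mn) =
      ((unifAbs k ^ (∑ i, v i) : ℝ≥0) : ℂ) * ∫ x in shell k v, f x ∂mn := by
  rw [integral_plusMeasure, ← integral_indicator (measurableSet_shell v), ← integral_const_mul]
  refine integral_congr_ae (ae_of_all _ fun x => ?_)
  by_cases hx : x ∈ shell k v
  · simp only [Set.indicator_of_mem hx]
    rw [prodAbs_eq_zpow, ← mem_shell.1 hx]
    rfl
  · simp [Set.indicator_of_notMem hx]

/-- Translating the $i$-th coordinate by $c_0/a_i$, which is smaller than the radius of the shell in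
that coordinate, preserves the shell and multiplies the integrand by $\psi(c_0)\neq1$. The density
of $d^+x$ is constant on the shell, so vanishing for $d^+x$ is vanishing for `mn`. -/
theorem integral_shell_addChar_eq_zero (ψ : AddChar k Circle) {c₀ : k} (hc₀ : ψ c₀ ≠ 1)
    (mn : Measure (Fin n → kˣ)) [mn.IsHaarMeasure] (v : Fin n → ℤ) (a : Fin n → k) (i : Fin n)
    (hi : ‖c₀‖ < ‖a i‖ * ‖(unif k : k)‖ ^ v i) :
    ∫ x in shell k v, (ψ (∑ j, a j * x j) : ℂ) ∂mn = 0 := by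
  have hai : a i ≠ 0 := by
    intro h
    rw [h, norm_zero, zero_mul] at hi
    exact absurd hi (norm_nonneg _).not_gt
  set c : Fin n → k := Pi.single i (c₀ / a i) with hc
  set F : (Fin n → k) → ℂ :=
    {z : Fin n → k | ∀ j, ‖z j‖ = ‖(unif k : k)‖ ^ v j}.indicator fun z => (ψ (∑ j, a j * z j) : ℂ) with hF
  have hcn : ∀ j, ‖c j‖ < ‖(unif k : k)‖ ^ v j := by
    intro j
    by_cases hj : j = i
    · subst hj
      rw [hc, Pi.single_eq_same, norm_div, div_lt_iff₀ (norm_pos_iff.2 hai), mul_comm]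
      exact hi
    · rw [hc, Pi.single_eq_of_ne hj, norm_zero]
      exact zpow_pos (norm_unif_pos k) _
  have hmem : ∀ z : Fin n → k, ∀ d : Fin n → k, (∀ j, ‖d j‖ < ‖(unif k : k)‖ ^ v j) →
      (∀ j, ‖z j‖ = ‖(unif k : k)‖ ^ v j) → ∀ j, ‖(z + d) j‖ = ‖(unif k : k)‖ ^ v j := by
    intro z d hd hz j
    rw [Pi.add_apply, norm_add_of_lt, hz j]
    rw [hz j]; exact hd j
  have hsum : ∀ z : Fin n → k, ∑ j, a j * (z + c) j = (∑ j, a j * z j) + c₀ := by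
    intro z
    simp_rw [Pi.add_apply, mul_add, Finset.sum_add_distrib]
    congr 1
    rw [Finset.sum_eq_single i]
    · rw [hc, Pi.single_eq_same, mul_div_cancel₀ _ hai]
    · intro j _ hj
      rw [hc, Pi.single_eq_of_ne hj, mul_zero]
    · simp
  have h0 := integral_plusMeasure_eq_zero mn F c (ζ := (ψ c₀ : ℂ))
    (fun h => hc₀ (Circle.ext (by simpa using h))) (fun z => ?_)
  · have e : ∀ x : Fin n → kˣ, F (coords x) =
        (shell k v).indicator (fun x => (ψ (∑ j, a j * x j) : ℂ)) x := by
      intro x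
      have hiff : (∀ j, ‖coords x j‖ = ‖(unif k : k)‖ ^ v j) ↔ x ∈ shell k v := by
        rw [mem_shell, funext_iff]
        exact forall_congr' fun j => ord_eq_iff.symm
      by_cases hx : x ∈ shell k v
      · rw [Set.indicator_of_mem hx, hF, Set.indicator_of_mem (by exact hiff.2 hx)]
        rfl
      · rw [Set.indicator_of_notMem hx, hF, Set.indicator_of_notMem (by exact fun h => hx (hiff.1 h))]
    simp_rw [e] at h0
    rw [integral_shell_eq] at h0
    refine (mul_eq_zero.1 h0).resolve_left ?_
    exact_mod_cast (zpow_pos unifAbs_pos _).ne'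
  · by_cases hz : ∀ j, ‖z j‖ = ‖(unif k : k)‖ ^ v j
    · rw [hF, Set.indicator_of_mem (by exact hmem z c hcn hz), Set.indicator_of_mem (by exact hz), hsum,
        AddChar.map_add_eq_mul, Circle.coe_mul, mul_comm]
    · rw [hF, Set.indicator_of_notMem, Set.indicator_of_notMem (by exact hz), mul_zero]
      intro h
      refine hz ?_
      have := hmem (z + c) (-c) (by simpa using hcn) h
      simpa using this

theorem measure_shell (mn : Measure (Fin n → kˣ)) [mn.IsHaarMeasure] (v : Fin n → ℤ) :
    mn (shell k v) = mn (shell k 0) := by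
  set g : Fin n → kˣ := fun i => unif k ^ v i with hg
  have hgv : ordVec g = v := by
    ext i; simp [hg]
  rw [← measure_preimage_mul mn g (shell k v)]
  congr 1
  ext x
  simp [mem_shell, ordVec_mul, hgv]

end Oscillation

/-! ### Second moment bound for the orbit integrals of $h_\psi$. -/

section UnitIntegral

open scoped NNReal ENNReal

variable {k : Type*} [NontriviallyNormedField k] [IsUltrametricDist k] [LocallyCompactSpace k]
variable {n r : ℕ} (w : Fin n → Fin r → ℤ) {ψ : AddChar k Circle}

theorem continuous_hPsi (hψ : Continuous ψ) : Continuous (hPsi ψ : (Fin n → kˣ) → ℂ) := by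
  unfold hPsi
  refine continuous_subtype_val.comp (hψ.comp ?_)
  exact continuous_finsetSum _ fun i _ => Units.continuous_val.comp (continuous_apply i)

@[simp] theorem norm_hPsi (x : Fin n → kˣ) : ‖hPsi ψ x‖ = 1 := Circle.norm_coe _

variable [MeasurableSpace k] [BorelSpace k]

theorem measurable_hPsi (hψ : Continuous ψ) : Measurable (hPsi ψ : (Fin n → kˣ) → ℂ) :=
  (continuous_hPsi hψ).measurable

variable (mU : Measure (dualMap (k := k) w).ker)

variable (ψ) in
/-- The integral of `h_ψ` over the orbit of `x` under the units of `U(k)`. -/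
def unitIntegral (x : Fin n → kˣ) : ℂ := ∫ u in kerUnits k w, hPsi ψ ((u : Fin n → kˣ) * x) ∂mU

variable [mU.IsHaarMeasure]

instance finite_restrict_kerUnits : IsFiniteMeasure (mU.restrict (kerUnits k w)) :=
  ⟨by rw [Measure.restrict_apply_univ]; exact kerUnits_lt_top w mU⟩

instance finite_restrict_shell (mn : Measure (Fin n → kˣ)) [mn.IsHaarMeasure] (v : Fin n → ℤ) :
    IsFiniteMeasure (mn.restrict (shell k v)) :=
  ⟨by rw [Measure.restrict_apply_univ]; exact (isCompact_shell v).measure_lt_top⟩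

theorem stronglyMeasurable_unitIntegral (hψ : Continuous ψ) :
    StronglyMeasurable (unitIntegral w ψ mU) := by
  refine StronglyMeasurable.integral_prod_right (f := fun x (u : (dualMap (k := k) w).ker) => hPsi ψ ((u : Fin n → kˣ) * x)) ?_
  exact ((measurable_hPsi hψ).comp (by fun_prop :
    Measurable fun p : (Fin n → kˣ) × (dualMap (k := k) w).ker => (p.2 : Fin n → kˣ) * p.1)).stronglyMeasurable

theorem norm_unitIntegral_le (x : Fin n → kˣ) : ‖unitIntegral w ψ mU x‖ ≤ mU.real (kerUnits k w) := by
  refine (norm_setIntegral_le_of_norm_le_const (C := 1) (kerUnits_lt_top w mU) fun u _ => ?_).trans_eq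
    (one_mul _)
  simp

theorem integrable_unitIntegral (hψ : Continuous ψ) (mn : Measure (Fin n → kˣ)) [mn.IsHaarMeasure]
    (v : Fin n → ℤ) : IntegrableOn (unitIntegral w ψ mU) (shell k v) mn :=
  Integrable.of_bound (stronglyMeasurable_unitIntegral w mU hψ).aestronglyMeasurable
    (mU.real (kerUnits k w)) (ae_of_all _ fun x => norm_unitIntegral_le w mU x)

theorem integral_norm_unitIntegral_le (hψ : Continuous ψ) (mn : Measure (Fin n → kˣ)) [mn.IsHaarMeasure]
    (v : Fin n → ℤ) : ∫ x in shell k v, ‖unitIntegral w ψ mU x‖ ∂mn ≤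
      mU.real (kerUnits k w) * mn.real (shell k 0) := by
  calc ∫ x in shell k v, ‖unitIntegral w ψ mU x‖ ∂mn
      ≤ ∫ x in shell k v, mU.real (kerUnits k w) ∂mn :=
        integral_mono (integrable_unitIntegral w mU hψ mn v).norm (integrable_const _)
          fun x => norm_unitIntegral_le w mU x
    _ = _ := by
      rw [integral_const, measureReal_restrict_apply_univ, smul_eq_mul, mul_comm, Measure.real,
        Measure.real, measure_shell mn v]
      rfl

theorem hPsi_mul_conj (x : Fin n → kˣ) (u u' : Fin n → kˣ) :
    hPsi ψ (u * x) * (starRingEnd ℂ) (hPsi ψ (u' * x)) =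
      (ψ (∑ j, ((u j : k) - u' j) * x j) : ℂ) := by
  unfold hPsi
  rw [← Circle.coe_inv_eq_conj, ← Circle.coe_mul, ← AddChar.map_neg_eq_inv, ← AddChar.map_add_eq_mul]
  congr 3
  rw [← sub_eq_add_neg, ← Finset.sum_sub_distrib]
  refine Finset.sum_congr rfl fun j _ => ?_
  simp [sub_mul]

variable (k) in
/-- The pairs of elements of `U(k)` that are close in the `i`-th coordinate. -/
def nearPairs (i : Fin n) (m : ℤ) : Set ((dualMap (k := k) w).ker × (dualMap (k := k) w).ker) :=
  {p | ‖(((p.1 : Fin n → kˣ) i : kˣ) : k) - (((p.2 : Fin n → kˣ) i : kˣ) : k)‖ ≤ ‖(unif k : k)‖ ^ m}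

theorem measurableSet_nearPairs (i : Fin n) (m : ℤ) : MeasurableSet (nearPairs k w i m) := by
  have hc : ∀ (π : ((dualMap (k := k) w).ker × (dualMap (k := k) w).ker) → (dualMap (k := k) w).ker),
      Continuous π → Continuous fun p => (((π p : Fin n → kˣ) i : kˣ) : k) := fun π hπ =>
    Units.continuous_val.comp ((continuous_apply i).comp (continuous_subtype_val.comp hπ))
  refine IsClosed.measurableSet (isClosed_le (Continuous.norm ?_) continuous_const)
  exact (hc _ continuous_fst).sub (hc _ continuous_snd)

/-- For fixed $u'$ with unit coordinates, translation by $u'^{-1}$ preserves the distance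
$|u_i-u'_i|$ and carries the slice into `kerUnitsNear`. -/
theorem measure_pairs_le (i : Fin n) (m : ℤ) :
    ((mU.restrict (kerUnits k w)).prod (mU.restrict (kerUnits k w))).real
      (nearPairs k w i m) ≤ mU.real (kerUnits k w) * mU.real (kerUnitsNear k w i m) := by
  set D := nearPairs k w i m with hD
  have hDm : MeasurableSet D := measurableSet_nearPairs w i m
  have hk := measurableSet_kerUnits (k := k) w
  have hle : ((mU.restrict (kerUnits k w)).prod (mU.restrict (kerUnits k w))) D ≤
      mU (kerUnits k w) * mU (kerUnitsNear k w i m) := by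
    rw [Measure.prod_apply_symm hDm]
    calc ∫⁻ u', (mU.restrict (kerUnits k w)) ((fun u => (u, u')) ⁻¹' D) ∂(mU.restrict (kerUnits k w))
        ≤ ∫⁻ u' in kerUnits k w, mU (kerUnitsNear k w i m) ∂mU := by
          refine setLIntegral_mono' hk fun u' hu' => ?_
          rw [Measure.restrict_apply' hk, ← measure_preimage_mul mU u'⁻¹ (kerUnitsNear k w i m)]
          refine measure_mono ?_
          rintro u ⟨hu1, hu2⟩
          have hu'1 : ‖(((u' : Fin n → kˣ) i : kˣ) : k)‖ = 1 := ord_eq_zero_iff.1 (congrFun hu' i)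
          refine ⟨?_, ?_⟩
          · change ordVec ((u' : Fin n → kˣ)⁻¹ * (u : Fin n → kˣ)) = 0
            rw [ordVec_mul, ordVec_inv, show ordVec (u' : Fin n → kˣ) = 0 from hu',
              show ordVec (u : Fin n → kˣ) = 0 from hu2]
            simp
          · rw [← one_mul ‖_ - 1‖, ← hu'1, ← norm_mul]
            refine le_of_eq_of_le ?_ hu1
            congr 1
            simp [mul_sub]
      _ = _ := by
          rw [setLIntegral_const, mul_comm]
  have := ENNReal.toReal_mono (ENNReal.mul_lt_top (kerUnits_lt_top w mU) (kerUnitsNear_lt_top w mU i m)).ne hle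
  rwa [ENNReal.toReal_mul] at this

/-- Expanding the square as a double integral over $(u,u')$ and integrating over $x$ first, the
inner integral vanishes as soon as $|u_i-u'_i||\varpi|^{v_i}>|c_0|$. Only the pairs in `nearPairs`
contribute, each at most the volume of the shell. -/
theorem integral_norm_sq_unitIntegral_le (hψ : Continuous ψ) {c₀ : kˣ} (hc₀ : ψ (c₀ : k) ≠ 1)
    (mn : Measure (Fin n → kˣ)) [mn.IsHaarMeasure] (v : Fin n → ℤ) (i : Fin n) :
    ∫ x in shell k v, ‖unitIntegral w ψ mU x‖ ^ 2 ∂mn ≤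
      mn.real (shell k 0) * (mU.real (kerUnits k w) * mU.real (kerUnitsNear k w i (ord c₀ - v i))) := by
  set ρ := mU.restrict (kerUnits k w) with hρ
  set μ := mn.restrict (shell k v) with hμ
  set D := nearPairs k w i (ord c₀ - v i) with hD
  have hDm : MeasurableSet D := measurableSet_nearPairs w i _
  set Φ : (Fin n → kˣ) → ((dualMap (k := k) w).ker × (dualMap (k := k) w).ker) → ℂ := fun x p =>
    hPsi ψ ((p.1 : Fin n → kˣ) * x) * (starRingEnd ℂ) (hPsi ψ ((p.2 : Fin n → kˣ) * x)) with hΦ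
  have hsq : ∀ x, ((‖unitIntegral w ψ mU x‖ ^ 2 : ℝ) : ℂ) = ∫ p, Φ x p ∂(ρ.prod ρ) := by
    intro x
    rw [hΦ, integral_prod_mul (fun u : (dualMap (k := k) w).ker => hPsi ψ ((u : Fin n → kˣ) * x))
      (fun u : (dualMap (k := k) w).ker => (starRingEnd ℂ) (hPsi ψ ((u : Fin n → kˣ) * x))), integral_conj]
    push_cast
    exact (Complex.mul_conj' _).symm
  have hΦm : StronglyMeasurable (Function.uncurry Φ) := by
    refine Measurable.stronglyMeasurable ?_
    have hm := measurable_hPsi (n := n) hψ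
    refine Measurable.mul (hm.comp ?_) (Complex.continuous_conj.measurable.comp (hm.comp ?_)) <;> fun_prop
  have hΦi : Integrable (Function.uncurry Φ) (μ.prod (ρ.prod ρ)) := by
    refine Integrable.of_bound hΦm.aestronglyMeasurable 1 (ae_of_all _ fun q => ?_)
    simp [Function.uncurry, hΦ]
  have hinner : ∀ p, ‖∫ x, Φ x p ∂μ‖ ≤ D.indicator (fun _ => mn.real (shell k 0)) p := by
    intro p
    by_cases hp : p ∈ D
    · rw [Set.indicator_of_mem hp]
      have h1 : ‖∫ x, Φ x p ∂μ‖ ≤ 1 * μ.real Set.univ :=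
        norm_integral_le_of_norm_le_const (ae_of_all _ fun x => by simp [hΦ])
      refine h1.trans_eq ?_
      rw [one_mul, hμ, measureReal_restrict_apply_univ, Measure.real, Measure.real, measure_shell mn v]
    · rw [Set.indicator_of_notMem hp, hΦ]
      simp_rw [hPsi_mul_conj]
      rw [integral_shell_addChar_eq_zero ψ hc₀ mn v _ i, norm_zero]
      have hp' : ‖(unif k : k)‖ ^ (ord c₀ - v i) <
          ‖(((p.1 : Fin n → kˣ) i : kˣ) : k) - (((p.2 : Fin n → kˣ) i : kˣ) : k)‖ := not_le.1 hp
      rw [norm_eq_zpow_ord c₀]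
      calc ‖(unif k : k)‖ ^ ord c₀ = ‖(unif k : k)‖ ^ (ord c₀ - v i) * ‖(unif k : k)‖ ^ v i := by
            rw [← zpow_add₀ (norm_unif_pos k).ne']; congr 1; ring
        _ < _ := mul_lt_mul_of_pos_right hp' (zpow_pos (norm_unif_pos k) _)
  have hfin : (∫ x in shell k v, ‖unitIntegral w ψ mU x‖ ^ 2 ∂mn : ℝ) =
      ‖∫ p, ∫ x, Φ x p ∂μ ∂(ρ.prod ρ)‖ := by
    rw [← integral_integral_swap hΦi]
    simp_rw [← hsq]
    rw [integral_complex_ofReal, Complex.norm_real, Real.norm_of_nonneg]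
    exact integral_nonneg fun x => by positivity
  rw [hfin]
  calc ‖∫ p, ∫ x, Φ x p ∂μ ∂(ρ.prod ρ)‖ ≤ ∫ p, D.indicator (fun _ => mn.real (shell k 0)) p ∂(ρ.prod ρ) :=
        norm_integral_le_of_norm_le ((integrable_const _).indicator hDm) (ae_of_all _ hinner)
    _ = mn.real (shell k 0) * (ρ.prod ρ).real D := by
        rw [integral_indicator_const _ hDm, smul_eq_mul, mul_comm]
    _ ≤ _ := by
        gcongr
        exact measure_pairs_le w mU i _

/-- The base of the exponential decay of the integrals of `unitIntegral` over shells. -/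
def decayBase : ℝ := Real.sqrt (1 / 2)

theorem decayBase_pos : 0 < decayBase := Real.sqrt_pos.2 (by norm_num)

theorem decayBase_sq : decayBase ^ 2 = 1 / 2 := Real.sq_sqrt (by norm_num)

theorem decayBase_lt_one : decayBase < 1 := by
  have := decayBase_sq
  nlinarith [decayBase_pos]

/-- The mean square is of order $2^{v_i}$, so the mean is of order its square root. The elementary
inequality $a\le\varepsilon+\varepsilon^{-1}a^2$ with $\varepsilon=2^{v_i/2}$ plays the role of
Cauchy–Schwarz. -/
theorem exists_integral_unitIntegral_le [CharZero k] (hψ : Continuous ψ) {c₀ : kˣ} (hc₀ : ψ (c₀ : k) ≠ 1)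
    (mn : Measure (Fin n → kˣ)) [mn.IsHaarMeasure] {l : Fin n → ℤ}
    (hl : ∀ j, ∑ i, l i * w i j = 0) {i : Fin n} (hi : l i ≠ 0) :
    ∃ C : ℝ, 0 ≤ C ∧ ∀ v : Fin n → ℤ,
      ∫ x in shell k v, ‖unitIntegral w ψ mU x‖ ∂mn ≤ C * decayBase ^ (-v i) := by
  obtain ⟨C, hC0, hC⟩ := exists_measure_kerUnitsNear_le w mU hl hi
  set V := mn.real (shell k (n := n) 0)
  set W := mU.real (kerUnits k w)
  have hV : 0 ≤ V := measureReal_nonneg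
  have hW : 0 ≤ W := measureReal_nonneg
  refine ⟨V + V * (W * (C * (1 / 2) ^ ord c₀)), by positivity, fun v => ?_⟩
  have hd := decayBase_pos
  set ε := decayBase ^ (-v i) with hε
  have hεpos : 0 < ε := zpow_pos hd _
  have hε2 : ((1 : ℝ) / 2) ^ (ord c₀ - v i) = (1 / 2) ^ ord c₀ * ε ^ 2 := by
    rw [hε, sub_eq_add_neg, zpow_add₀ (by norm_num), ← decayBase_sq, ← zpow_natCast, ← zpow_natCast,
      ← zpow_mul, ← zpow_mul, ← zpow_mul, mul_comm (-v i)]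
  have h2 := integral_norm_sq_unitIntegral_le w mU hψ hc₀ mn v i
  have hI := integrable_unitIntegral w mU hψ mn v
  have hI2 : IntegrableOn (fun x => ‖unitIntegral w ψ mU x‖ ^ 2) (shell k v) mn := by
    refine Integrable.of_bound
      ((stronglyMeasurable_unitIntegral w mU hψ).norm.pow 2).aestronglyMeasurable (W ^ 2)
      (ae_of_all _ fun x => ?_)
    rw [norm_pow, norm_norm]
    gcongr
    exact norm_unitIntegral_le w mU x
  calc ∫ x in shell k v, ‖unitIntegral w ψ mU x‖ ∂mn
      ≤ ∫ x in shell k v, (ε + ε⁻¹ * ‖unitIntegral w ψ mU x‖ ^ 2) ∂mn := by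
        refine integral_mono hI.norm ((integrable_const _).add (hI2.const_mul _)) fun x => ?_
        set a := ‖unitIntegral w ψ mU x‖ with ha
        change a ≤ ε + ε⁻¹ * a ^ 2
        have : ε * a ≤ ε * (ε + ε⁻¹ * a ^ 2) := by
          rw [mul_add, ← mul_assoc, mul_inv_cancel₀ hεpos.ne']
          nlinarith [sq_nonneg (ε - a), sq_nonneg ε, sq_nonneg a]
        exact le_of_mul_le_mul_left this hεpos
    _ = ε * V + ε⁻¹ * ∫ x in shell k v, ‖unitIntegral w ψ mU x‖ ^ 2 ∂mn := by
        rw [integral_add (integrable_const _) (hI2.const_mul _), integral_const_mul, integral_const,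
          measureReal_restrict_apply_univ, smul_eq_mul, mul_comm, Measure.real, measure_shell mn v]
        rfl
    _ ≤ ε * V + ε⁻¹ * (V * (W * (C * ((1 / 2) ^ ord c₀ * ε ^ 2)))) := by
        gcongr
        refine h2.trans ?_
        gcongr
        rw [← hε2]
        exact hC _
    _ = _ := by
        field_simp

end UnitIntegral

/-! ### The exponential bounds that make the sum over pairs of shells converge. -/

section Summation

theorem summable_pow_sum_abs {β : ℝ} (h0 : 0 < β) (h1 : β < 1) (n : ℕ) :
    Summable fun v : Fin n → ℤ => β ^ (∑ i, |v i|) := by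
  have hone : Summable fun m : ℤ => β ^ |m| := by
    refine Summable.of_nat_of_neg ?_ ?_ <;> simpa using summable_geometric_of_lt_one h0.le h1
  induction n with
  | zero => exact Summable.of_finite
  | succ n ih =>
    have h := hone.mul_of_nonneg ih (fun m => (zpow_pos h0 _).le) (fun v => (zpow_pos h0 _).le)
    refine ((Fin.consEquiv fun _ : Fin (n + 1) => ℤ).summable_iff).1 (h.congr fun p => ?_)
    simp [Fin.consEquiv, Fin.sum_univ_succ, zpow_add₀ h0.ne']

theorem exists_lt_one_le_pow {q : ℝ} (hq : q < 1) (N : ℕ) : ∃ β : ℝ, 0 < β ∧ β < 1 ∧ q ≤ β ^ N := by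
  have h : Tendsto (fun β : ℝ => β ^ N) (𝓝[<] 1) (𝓝 1) := by
    have := (continuous_pow N : Continuous fun β : ℝ => β ^ N).tendsto 1
    rw [one_pow] at this
    exact this.mono_left nhdsWithin_le_nhds
  have h2 : ∀ᶠ β : ℝ in 𝓝[<] 1, q < β ^ N := h.eventually (lt_mem_nhds hq)
  have h3 : ∀ᶠ β : ℝ in 𝓝[<] 1, β ∈ Set.Ioo (0 : ℝ) 1 := Ioo_mem_nhdsLT zero_lt_one
  obtain ⟨β, hβ1, hβ2⟩ := (h2.and h3).exists
  exact ⟨β, hβ2.1, hβ2.2, hβ1.le⟩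

/-- With $S$ the common sum, the lower bounds on the entries give $\sum|v_i|\le S+2nA$ and
$\sum|v'_i|\le S+2nM$. A large $S$ is paid for by $q^S$ and a large $A$ by $\theta^A$: the former
yields $\beta^{2(S+nM)}$ and the latter $\beta^{2nA}$, whose exponents together dominate both sums.
-/
theorem zpow_mul_zpow_le {n : ℕ} {q θ β : ℝ} (hq : 0 < q) (hθ : 0 < θ) (hβ0 : 0 < β) (hβ1 : β < 1)
    (hqβ : q ≤ β ^ 2) (hθβ : θ ≤ β ^ (2 * n)) {A M : ℤ} (hA : 0 ≤ A) (hM : 0 ≤ M)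
    {v v' : Fin n → ℤ} (hv : ∀ i, -A ≤ v i) (hv' : ∀ i, -M ≤ v' i) (hs : ∑ i, v i = ∑ i, v' i) :
    q ^ (∑ i, v' i) * θ ^ A ≤ q ^ (-(n * M)) * (β ^ (∑ i, |v i|) * β ^ (∑ i, |v' i|)) := by
  set S := ∑ i, v' i with hS
  have h1 : ∑ i, |v i| ≤ S + 2 * n * A := by
    calc ∑ i, |v i| ≤ ∑ i, (v i + 2 * A) := by
          refine Finset.sum_le_sum fun i _ => ?_
          have := hv i
          rcases abs_cases (v i) with h | h <;> omega
      _ = _ := by rw [Finset.sum_add_distrib, hs]; simp; ring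
  have h2 : ∑ i, |v' i| ≤ S + 2 * n * M := by
    calc ∑ i, |v' i| ≤ ∑ i, (v' i + 2 * M) := by
          refine Finset.sum_le_sum fun i _ => ?_
          have := hv' i
          rcases abs_cases (v' i) with h | h <;> omega
      _ = _ := by rw [Finset.sum_add_distrib]; simp; ring
  have h3 : 0 ≤ S + n * M := by
    have : ∑ i : Fin n, (-M) ≤ S := Finset.sum_le_sum fun i _ => hv' i
    simp at this
    linarith
  have e1 : q ^ S ≤ q ^ (-(n * M)) * β ^ (2 * (S + n * M)) := by
    have : q ^ S = q ^ (-(n * M) : ℤ) * q ^ (S + n * M) := by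
      rw [← zpow_add₀ hq.ne']; congr 1; ring
    rw [this, zpow_mul]
    refine mul_le_mul_of_nonneg_left ?_ (zpow_pos hq _).le
    obtain ⟨m, hm⟩ := Int.eq_ofNat_of_zero_le h3
    rw [hm, zpow_natCast, zpow_natCast]
    exact pow_le_pow_left₀ hq.le (by exact_mod_cast hqβ) m
  have e2 : θ ^ A ≤ β ^ (2 * n * A) := by
    obtain ⟨m, rfl⟩ := Int.eq_ofNat_of_zero_le hA
    rw [zpow_mul, zpow_natCast, zpow_natCast]
    refine pow_le_pow_left₀ hθ.le ?_ m
    exact_mod_cast hθβ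
  calc q ^ S * θ ^ A ≤ (q ^ (-(n * M)) * β ^ (2 * (S + n * M))) * β ^ (2 * n * A) :=
        mul_le_mul e1 e2 (zpow_pos hθ _).le (mul_pos (zpow_pos hq _) (zpow_pos hβ0 _)).le
    _ = q ^ (-(n * M)) * β ^ (2 * (S + n * M) + 2 * n * A) := by
        rw [mul_assoc, ← zpow_add₀ hβ0.ne']
    _ ≤ _ := by
        rw [← zpow_add₀ hβ0.ne']
        refine mul_le_mul_of_nonneg_left ?_ (zpow_pos hq _).le
        refine zpow_le_zpow_right_of_le_one₀ hβ0 hβ1.le ?_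
        linarith

end Summation

/-! ### Shells of a fibre as orbits of the units of $U(k)$. -/

section Shells

open scoped NNReal ENNReal

variable {k : Type*} [NontriviallyNormedField k] [IsUltrametricDist k] [LocallyCompactSpace k]
variable {n r : ℕ} (w : Fin n → Fin r → ℤ) {ψ : AddChar k Circle}

theorem charEval_dualMap {ν : Fin r → ℤ} (hν : ∀ i, ∑ j, ν j * w i j = 1) (x : Fin n → kˣ) :
    charEval ν (dualMap w x) = ∏ i, x i := by
  have h : ∀ (y : kˣ) (S : Finset (Fin r)) (f : Fin r → ℤ), ∏ i ∈ S, y ^ f i = y ^ ∑ i ∈ S, f i := by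
    intro y S f
    classical
    induction S using Finset.induction_on with
    | empty => simp
    | insert a S ha ih => rw [Finset.prod_insert ha, Finset.sum_insert ha, zpow_add, ih]
  change ∏ j, (∏ i, x i ^ w i j) ^ ν j = _
  simp_rw [← Finset.prod_zpow, ← zpow_mul]
  rw [Finset.prod_comm]
  simp_rw [h, mul_comm (w _ _), hν, zpow_one]

theorem normAbs_charEval {ν : Fin r → ℤ} (hν : ∀ i, ∑ j, ν j * w i j = 1) (x : Fin n → kˣ) :
    normAbs (charEval ν (dualMap w x)) = prodAbs x := by
  rw [charEval_dualMap w hν, normAbs_prod]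

theorem sum_ord_eq {ν : Fin r → ℤ} (hν : ∀ i, ∑ j, ν j * w i j = 1) {x y : Fin n → kˣ}
    (h : dualMap w x = dualMap w y) : ∑ i, ord (x i) = ∑ i, ord (y i) := by
  rw [← ord_prod, ← ord_prod, ← charEval_dualMap w hν, ← charEval_dualMap w hν, h]

theorem sum_ordVec_ker (u : (dualMap (k := k) w).ker) (j : Fin r) :
    ∑ i, ordVec (u : Fin n → kˣ) i * w i j = 0 := by
  have h := congrFun ((MonoidHom.mem_ker).1 u.2) j
  have h2 : ord (∏ i, (u : Fin n → kˣ) i ^ w i j) = 0 := by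
    rw [show ∏ i, (u : Fin n → kˣ) i ^ w i j = 1 from h, ord_one]
  rw [ord_prod] at h2
  simpa [mul_comm] using h2

variable [MeasurableSpace k] [BorelSpace k]
variable (mU : Measure (dualMap (k := k) w).ker)

variable (ψ) in
/-- The integral of `h_ψ` over the points of given valuations in a fibre. -/
def shellIntegral (v : Fin n → ℤ) (t : Fin r → kˣ) : ℂ :=
  ∫ x in shell k v, hPsi ψ x ∂(fibreMeasure w mU t)

variable [mU.IsHaarMeasure]

theorem measurable_shellIntegral (hψ : Continuous ψ) (v : Fin n → ℤ) :
    StronglyMeasurable (shellIntegral w ψ mU v) := by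
  have h : StronglyMeasurable ((shell k v).indicator (hPsi ψ : (Fin n → kˣ) → ℂ)) :=
    ((measurable_hPsi hψ).indicator (measurableSet_shell v)).stronglyMeasurable
  have := h.integral_kernel (κ := fibreKernel w mU)
  simp_rw [integral_indicator (measurableSet_shell v), fibreKernel_apply] at this
  exact this

/-- The points of the fibre with valuations $v$ form the single orbit of $u_0x$ under `kerUnits`;
translating `mU` by $u_0$ moves the base point there. -/
theorem shellIntegral_eq_unitIntegral (hψ : Continuous ψ) {v : Fin n → ℤ} {x : Fin n → kˣ}
    {u₀ : (dualMap (k := k) w).ker} (hu : ordVec (u₀ : Fin n → kˣ) + ordVec x = v) :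
    shellIntegral w ψ mU v (dualMap w x) = unitIntegral w ψ mU ((u₀ : Fin n → kˣ) * x) := by
  rw [shellIntegral, ← integral_indicator (measurableSet_shell v),
    integral_fibreMeasure w mU x ((measurable_hPsi hψ).indicator (measurableSet_shell v)),
    unitIntegral, ← integral_indicator (measurableSet_kerUnits w),
    ← integral_mul_right_eq_self _ u₀]
  refine integral_congr_ae (ae_of_all _ fun u => ?_)
  have hmem : ((u * u₀ : (dualMap (k := k) w).ker) : Fin n → kˣ) * x ∈ shell k v ↔ u ∈ kerUnits k w := by
    change ordVec ((u : Fin n → kˣ) * (u₀ : Fin n → kˣ) * x) = v ↔ ordVec (u : Fin n → kˣ) = 0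
    rw [mul_assoc, ordVec_mul, ordVec_mul, hu]
    simp
  by_cases h : u ∈ kerUnits k w
  · simp only [Set.indicator_of_mem h, Set.indicator_of_mem (hmem.2 h)]
    rw [Subgroup.coe_mul, mul_assoc]
  · simp only [Set.indicator_of_notMem h, Set.indicator_of_notMem (fun h' => h (hmem.1 h'))]

theorem fibreMeasure_shell_eq_zero {v : Fin n → ℤ} {x : Fin n → kˣ}
    (hu : ¬ ∃ u : (dualMap (k := k) w).ker, ordVec (u : Fin n → kˣ) + ordVec x = v) :
    fibreMeasure w mU (dualMap w x) (shell k v) = 0 := by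
  rw [fibreMeasure_dualMap_apply w mU x (measurableSet_shell v)]
  convert measure_empty (μ := mU)
  ext u
  simp only [Set.mem_ofPred_eq, Set.mem_empty_iff_false, iff_false]
  intro h
  exact hu ⟨u, by rw [← ordVec_mul]; exact h⟩

theorem fibreMeasure_shell_le (v : Fin n → ℤ) (x : Fin n → kˣ) :
    fibreMeasure w mU (dualMap w x) (shell k v) ≤ mU (kerUnits k w) := by
  by_cases hu : ∃ u : (dualMap (k := k) w).ker, ordVec (u : Fin n → kˣ) + ordVec x = v
  · obtain ⟨u₀, hu⟩ := hu
    rw [fibreMeasure_dualMap_apply w mU x (measurableSet_shell v),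
      ← measure_preimage_mul_right mU u₀⁻¹ (kerUnits k w)]
    refine measure_mono fun u h => ?_
    change ordVec ((u : Fin n → kˣ) * (u₀ : Fin n → kˣ)⁻¹) = 0
    have h' : ordVec ((u : Fin n → kˣ) * x) = v := h
    rw [ordVec_mul] at h' ⊢
    rw [ordVec_inv, ← sub_eq_add_neg, sub_eq_zero]
    rw [← hu] at h'
    exact add_right_cancel h'
  · rw [fibreMeasure_shell_eq_zero w mU hu]
    exact zero_le

theorem shellIntegral_eq_zero {v : Fin n → ℤ} {x : Fin n → kˣ}
    (hu : ¬ ∃ u : (dualMap (k := k) w).ker, ordVec (u : Fin n → kˣ) + ordVec x = v) :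
    shellIntegral w ψ mU v (dualMap w x) = 0 := by
  rw [shellIntegral, Measure.restrict_eq_zero.2 (fibreMeasure_shell_eq_zero w mU hu), integral_zero_measure]

/-- Multiplication by $u_0$ preserves `mn` and carries the shell $v'$ of base points onto the shell
$v$ of the fibre points, where the bounds for `unitIntegral` apply. -/
theorem lintegral_shellIntegral_eq (hψ : Continuous ψ) (mn : Measure (Fin n → kˣ)) [mn.IsHaarMeasure]
    {v v' : Fin n → ℤ} {u₀ : (dualMap (k := k) w).ker} (hu : ordVec (u₀ : Fin n → kˣ) + v' = v) :
    ∫⁻ x in shell k v', ‖shellIntegral w ψ mU v (dualMap w x)‖ₑ ∂mn =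
      ∫⁻ x in shell k v, ‖unitIntegral w ψ mU x‖ₑ ∂mn := by
  rw [← lintegral_indicator (measurableSet_shell _), ← lintegral_indicator (measurableSet_shell _),
    ← lintegral_mul_left_eq_self (μ := mn) ((shell k v).indicator fun x => ‖unitIntegral w ψ mU x‖ₑ)
      (u₀ : Fin n → kˣ)]
  refine lintegral_congr fun x => ?_
  have hmem : (u₀ : Fin n → kˣ) * x ∈ shell k v ↔ x ∈ shell k v' := by
    rw [mem_shell, mem_shell, ordVec_mul, ← hu, add_right_inj]
  by_cases h : x ∈ shell k v'
  · rw [Set.indicator_of_mem h, Set.indicator_of_mem (hmem.2 h),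
      shellIntegral_eq_unitIntegral w mU hψ (u₀ := u₀)]
    rw [mem_shell.1 h, hu]
  · rw [Set.indicator_of_notMem h, Set.indicator_of_notMem (fun h' => h (hmem.1 h'))]

/-- The coordinates of the points of a polydisc have bounded below valuations. -/
theorem exists_polydisc_subset (R : ℝ) : ∃ M : ℤ, 0 ≤ M ∧ ∀ x : Fin n → kˣ, x ∈ polydisc R →
    ∀ i, -M ≤ ord (x i) := by
  obtain ⟨m, hm⟩ := pow_unbounded_of_one_lt R ((one_lt_inv₀ (norm_unif_pos k)).2 (norm_unif_lt_one k))
  refine ⟨m, by positivity, fun x hx i => ?_⟩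
  have h := (hx i).trans hm.le
  rw [norm_eq_zpow_ord, inv_pow, ← zpow_natCast, ← zpow_neg, zpow_unif_le_iff] at h
  exact h

/-- The sum of the valuations is constant on a fibre, so lower bounds on all of them imply upper
bounds; the fibre meets the polydisc in finitely many compact shells. -/
theorem fibreMeasure_polydisc_lt_top {ν : Fin r → ℤ} (hν : ∀ i, ∑ j, ν j * w i j = 1) (R : ℝ)
    (t : Fin r → kˣ) : fibreMeasure w mU t (polydisc R) < ⊤ := by
  by_cases ht : t ∈ Set.range (dualMap (k := k) w)
  swap
  · simp [fibreMeasure_of_notMem w mU ht]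
  obtain ⟨y, rfl⟩ := ht
  obtain ⟨M, hM0, hM⟩ := exists_polydisc_subset (k := k) (n := n) R
  set S := ∑ i, ord (y i) with hS
  have hfin : (Set.Icc (fun _ => -M) (fun _ => S + n * M) : Set (Fin n → ℤ)).Finite := Set.finite_Icc _ _
  have hc : IsCompact (⋃ v ∈ (Set.Icc (fun _ => -M) (fun _ => S + n * M) : Set (Fin n → ℤ)), shell k v) :=
    hfin.isCompact_biUnion fun v _ => isCompact_shell v
  refine lt_of_le_of_lt (measure_mono_ae ?_) (fibreMeasure_lt_top_of_isCompact w mU (dualMap w y) hc)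
  filter_upwards [ae_fibreMeasure w mU (dualMap w y)] with x hx hxR
  have h1 := sum_ord_eq w hν hx
  have h2 := hM x hxR
  refine Set.mem_biUnion (x := ordVec x) ⟨fun i => h2 i, fun i => ?_⟩ rfl
  have h3 : ∑ j ∈ Finset.univ.erase i, (-M) ≤ ∑ j ∈ Finset.univ.erase i, ord (x j) :=
    Finset.sum_le_sum fun j _ => h2 j
  rw [← Finset.add_sum_erase _ _ (Finset.mem_univ i)] at h1
  rw [Finset.sum_const, Finset.card_erase_of_mem (Finset.mem_univ i), Finset.card_univ, Fintype.card_fin,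
    nsmul_eq_mul] at h3
  have hn : 1 ≤ n := i.pos
  push_cast [Nat.cast_sub hn] at h3
  change ord (x i) ≤ S + n * M
  linarith

end Shells

/-! ### Integrability over polydiscs of sums over the shells of fibres. -/

section Absolute

open scoped NNReal ENNReal

variable {k : Type*} [NontriviallyNormedField k] [IsUltrametricDist k] [LocallyCompactSpace k]
variable {n r : ℕ} (w : Fin n → Fin r → ℤ) {ψ : AddChar k Circle}
variable [MeasurableSpace k] [BorelSpace k]

theorem lintegral_shell_plusMeasure (mn : Measure (Fin n → kˣ)) (v : Fin n → ℤ)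
    {f : (Fin n → kˣ) → ℝ≥0∞} (hf : Measurable f) :
    ∫⁻ x in shell k v, f x ∂(plusMeasure mn) =
      ((unifAbs k ^ (∑ i, v i) : ℝ≥0) : ℝ≥0∞) * ∫⁻ x in shell k v, f x ∂mn := by
  rw [plusMeasure, setLIntegral_withDensity_eq_setLIntegral_mul _ measurable_prodAbs.coe_nnreal_ennreal hf
    (measurableSet_shell v), ← lintegral_const_mul _ hf]
  refine setLIntegral_congr_fun (measurableSet_shell v) fun x hx => ?_
  simp only [Pi.mul_apply]
  rw [prodAbs_eq_zpow, ← mem_shell.1 hx]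
  rfl

/-- Here $v'$ is the shell of the base point and $v$ that of a point in its fibre. Passing to $d^+x$
contributes the factor $q^{\sum v'_i}$, and `zpow_mul_zpow_le` then bounds each term by a product of
summable functions of $v$ and of $v'$. Used twice: for the oscillatory kernel, and for the volumes
of truncated fibres. -/
theorem lintegral_polydisc_tsum_lt_top (mn : Measure (Fin n → kˣ)) {f : (Fin n → ℤ) → (Fin n → kˣ) → ℝ≥0∞}
    (hf : ∀ v, Measurable (f v)) {θ c : ℝ} (hθ0 : 0 < θ) (hθ1 : θ < 1) (hc : 0 ≤ c) {R : ℝ} {M : ℤ} (hM0 : 0 ≤ M)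
    (hM : ∀ x : Fin n → kˣ, x ∈ polydisc R → ∀ i, -M ≤ ord (x i))
    (H : ∀ v v' : Fin n → ℤ, (∀ i, -M ≤ v' i) → ∫⁻ x in shell k v', f v x ∂mn = 0 ∨
      ∃ A : ℤ, 0 ≤ A ∧ (∀ i, -A ≤ v i) ∧ ∑ i, v i = ∑ i, v' i ∧
        ∫⁻ x in shell k v', f v x ∂mn ≤ ENNReal.ofReal (c * θ ^ A)) :
    ∫⁻ x in polydisc R, ∑' v, f v x ∂(plusMeasure mn) < ⊤ := by
  set q : ℝ := (unifAbs k : ℝ) with hqdef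
  have hq0 : 0 < q := by exact_mod_cast unifAbs_pos
  have hq1 : q < 1 := by exact_mod_cast unifAbs_lt_one
  -- The exponent exceeds both $2$ and $2n$, the powers of $\beta$ required to dominate $q$ and
  -- $\theta$.
  obtain ⟨β, hβ0, hβ1, hβ⟩ := exists_lt_one_le_pow (max_lt hq1 hθ1) (2 * n + 2)
  have hqβ : q ≤ β ^ 2 := (le_max_left _ _).trans (hβ.trans
    (pow_le_pow_of_le_one hβ0.le hβ1.le (by omega)))
  have hθβ : θ ≤ β ^ (2 * n) := (le_max_right _ _).trans (hβ.trans
    (pow_le_pow_of_le_one hβ0.le hβ1.le (by omega)))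
  set a : (Fin n → ℤ) → ℝ := fun v => β ^ (∑ i, |v i|) with ha
  have ha0 : ∀ v, 0 ≤ a v := fun v => (zpow_pos hβ0 _).le
  set K : ℝ := c * q ^ (-(n * M)) with hK
  have hK0 : 0 ≤ K := mul_nonneg hc (zpow_pos hq0 _).le
  have hfs : Measurable fun x => ∑' v, f v x := Measurable.tsum hf
  have hterm : ∀ v v' : Fin n → ℤ, (∀ i, -M ≤ v' i) → ∫⁻ x in shell k v', f v x ∂(plusMeasure mn) ≤
      ENNReal.ofReal K * (ENNReal.ofReal (a v) * ENNReal.ofReal (a v')) := by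
    intro v v' hv'
    rw [lintegral_shell_plusMeasure mn v' (hf v)]
    rcases H v v' hv' with h | ⟨A, hA, hv, hs, h⟩
    · rw [h, mul_zero]; exact zero_le
    · refine (mul_le_mul_right h _).trans ?_
      rw [← ENNReal.ofReal_mul (ha0 v), ← ENNReal.ofReal_mul hK0,
        show ((unifAbs k ^ (∑ i, v' i) : ℝ≥0) : ℝ≥0∞) = ENNReal.ofReal (q ^ (∑ i, v' i)) by
          rw [hqdef, ← NNReal.coe_zpow, ENNReal.ofReal_coe_nnreal],
        ← ENNReal.ofReal_mul (zpow_pos hq0 _).le]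
      refine ENNReal.ofReal_le_ofReal ?_
      have := zpow_mul_zpow_le hq0 hθ0 hβ0 hβ1 hqβ hθβ hA hM0 hv hv' hs
      calc q ^ (∑ i, v' i) * (c * θ ^ A) = c * (q ^ (∑ i, v' i) * θ ^ A) := by ring
        _ ≤ c * (q ^ (-(n * M)) * (a v * a v')) := mul_le_mul_of_nonneg_left this hc
        _ = _ := by rw [hK]; ring
  have hcover : (polydisc R : Set (Fin n → kˣ)) = ⋃ v', (polydisc R ∩ shell k v') := by
    rw [← Set.inter_iUnion, iUnion_shell, Set.inter_univ]
  calc ∫⁻ x in polydisc R, ∑' v, f v x ∂(plusMeasure mn)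
      ≤ ∑' v', ∫⁻ x in polydisc R ∩ shell k v', ∑' v, f v x ∂(plusMeasure mn) := by
        conv_lhs => rw [hcover]
        exact lintegral_iUnion_le _ _
    _ ≤ ∑' v', ∑' v, ENNReal.ofReal K * (ENNReal.ofReal (a v) * ENNReal.ofReal (a v')) := by
        refine ENNReal.tsum_le_tsum fun v' => ?_
        by_cases hv' : ∀ i, -M ≤ v' i
        · refine (lintegral_mono_set Set.inter_subset_right).trans ?_
          rw [lintegral_tsum fun v => (hf v).aemeasurable]
          exact ENNReal.tsum_le_tsum fun v => hterm v v' hv'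
        · have : polydisc R ∩ shell k v' = ∅ := by
            ext x
            simp only [Set.mem_inter_iff, Set.mem_empty_iff_false, iff_false, not_and]
            intro hx hx'
            refine hv' fun i => ?_
            rw [← mem_shell.1 hx']
            exact hM x hx i
          rw [this]
          simp
    _ = ENNReal.ofReal K * ((∑' v, ENNReal.ofReal (a v)) * ∑' v', ENNReal.ofReal (a v')) := by
        simp_rw [ENNReal.tsum_mul_left, ENNReal.tsum_mul_right]
        rw [ENNReal.tsum_mul_left]
    _ < ⊤ := by
        have hs : ∑' v, ENNReal.ofReal (a v) < ⊤ := by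
          rw [← ENNReal.ofReal_tsum_of_nonneg ha0 (summable_pow_sum_abs hβ0 hβ1 n)]
          exact ENNReal.ofReal_lt_top
        exact ENNReal.mul_lt_top ENNReal.ofReal_lt_top (ENNReal.mul_lt_top hs hs)

variable (mU : Measure (dualMap (k := k) w).ker) [mU.IsHaarMeasure]

variable (ψ) in
/-- The sum of the absolute values of the integrals of `h_ψ` over the shells of a fibre. -/
def absKernel (t : Fin r → kˣ) : ℝ≥0∞ := ∑' v, ‖shellIntegral w ψ mU v t‖ₑ

theorem measurable_absKernel (hψ : Continuous ψ) : Measurable (absKernel w ψ mU) :=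
  Measurable.tsum fun v => (measurable_shellIntegral w mU hψ v).enorm

theorem sum_eq_of_ordVec_add {ν : Fin r → ℤ} (hν : ∀ i, ∑ j, ν j * w i j = 1)
    {u : (dualMap (k := k) w).ker} {v v' : Fin n → ℤ} (hu : ordVec (u : Fin n → kˣ) + v' = v) :
    ∑ i, v i = ∑ i, v' i := by
  have h : ∑ i, ordVec (u : Fin n → kˣ) i = 0 := by
    have h1 : dualMap w (u : Fin n → kˣ) = dualMap w 1 := by
      rw [(MonoidHom.mem_ker).1 u.2, map_one]
    have := sum_ord_eq w hν h1
    simpa using this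
  rw [← hu]
  simp [Finset.sum_add_distrib, Pi.add_apply] at h ⊢
  exact h

/-- Shells of the fibre bounded below by $-M$ need only the trivial volume bound. Any other shell
has a coordinate that some $u\in U(k)$ has pushed below the polydisc, and there the oscillation
estimate gives decay. -/
theorem lintegral_absKernel_lt_top [CharZero k] (hψ : Continuous ψ) (hψ1 : ψ ≠ 1)
    {ν : Fin r → ℤ} (hν : ∀ i, ∑ j, ν j * w i j = 1)
    (mn : Measure (Fin n → kˣ)) [mn.IsHaarMeasure] (R : ℝ) :
    ∫⁻ x in polydisc R, absKernel w ψ mU (dualMap w x) ∂(plusMeasure mn) < ⊤ := by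
  obtain ⟨c₀', hc₀'⟩ := DFunLike.ne_iff.1 hψ1
  have hc₀0 : c₀' ≠ 0 := by rintro rfl; simp at hc₀'
  set c₀ : kˣ := Units.mk0 c₀' hc₀0
  have hc₀ : ψ (c₀ : k) ≠ 1 := hc₀'
  obtain ⟨M, hM0, hM⟩ := exists_polydisc_subset (k := k) (n := n) R
  have hθ0 := decayBase_pos
  have hθ1 := decayBase_lt_one
  -- The estimate does not mention the relation, so the constant from one relation with $l_i\neq0$
  -- serves for all; if there is none, any constant will do. Uniformity in $l$ matters because $l$
  -- will depend on the shells.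
  have hex : ∀ i : Fin n, ∃ C : ℝ, 0 ≤ C ∧ ∀ l : Fin n → ℤ, (∀ j, ∑ i, l i * w i j = 0) → l i ≠ 0 →
      ∀ v : Fin n → ℤ, ∫ x in shell k v, ‖unitIntegral w ψ mU x‖ ∂mn ≤ C * decayBase ^ (-v i) := by
    intro i
    by_cases h : ∃ l : Fin n → ℤ, (∀ j, ∑ i, l i * w i j = 0) ∧ l i ≠ 0
    · obtain ⟨l, hl, hi⟩ := h
      obtain ⟨C, hC0, hC⟩ := exists_integral_unitIntegral_le w mU hψ hc₀ mn hl hi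
      exact ⟨C, hC0, fun _ _ _ => hC⟩
    · exact ⟨0, le_rfl, fun l hl hi => absurd ⟨l, hl, hi⟩ h⟩
  choose C hC0 hC using hex
  set D : ℝ := mU.real (kerUnits k w) * mn.real (shell k (n := n) 0) with hD
  have hD0 : 0 ≤ D := mul_nonneg measureReal_nonneg measureReal_nonneg
  have hCs : 0 ≤ ∑ i, C i := Finset.sum_nonneg fun i _ => hC0 i
  have hMp : 0 < decayBase ^ (-M) := zpow_pos hθ0 _
  refine lintegral_polydisc_tsum_lt_top (c := D * decayBase ^ (-M) + ∑ i, C i) mn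
    (fun v => (measurable_shellIntegral w mU hψ v).enorm.comp (measurable_dualMap w)) hθ0 hθ1
    (by positivity) hM0 hM fun v v' hv' => ?_
  by_cases hu : ∃ u : (dualMap (k := k) w).ker, ordVec (u : Fin n → kˣ) + v' = v
  swap
  · left
    rw [← lintegral_indicator (measurableSet_shell v')]
    refine (lintegral_congr fun x => ?_).trans lintegral_zero
    by_cases hx : x ∈ shell k v'
    · rw [Set.indicator_of_mem hx]
      change ‖shellIntegral w ψ mU v (dualMap w x)‖ₑ = 0
      rw [shellIntegral_eq_zero w mU (by rwa [mem_shell.1 hx]), enorm_zero]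
    · rw [Set.indicator_of_notMem hx]
  right
  obtain ⟨u, hu⟩ := hu
  have hrel := sum_ordVec_ker w u
  have hsum := sum_eq_of_ordVec_add w hν hu
  have hval : ∫⁻ x in shell k v', ‖shellIntegral w ψ mU v (dualMap w x)‖ₑ ∂mn =
      ENNReal.ofReal (∫ x in shell k v, ‖unitIntegral w ψ mU x‖ ∂mn) := by
    rw [lintegral_shellIntegral_eq w mU hψ mn hu,
      ofReal_integral_norm_eq_lintegral_enorm (integrable_unitIntegral w mU hψ mn v)]
  change ∃ A : ℤ, 0 ≤ A ∧ _ ∧ _ ∧ ∫⁻ x in shell k v', ‖shellIntegral w ψ mU v (dualMap w x)‖ₑ ∂mn ≤ _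
  rw [hval]
  by_cases hv : ∀ i, -M ≤ v i
  -- No decay is needed: the factor `decayBase ^ (-M)` in the constant compensates `decayBase ^ M`.
  · refine ⟨M, hM0, hv, hsum, ENNReal.ofReal_le_ofReal ?_⟩
    refine (integral_norm_unitIntegral_le w mU hψ mn v).trans ?_
    rw [add_mul, mul_assoc, ← zpow_add₀ hθ0.ne', neg_add_cancel, zpow_zero, mul_one]
    have := mul_nonneg hCs (zpow_pos hθ0 M).le
    linarith
  · push Not at hv
    obtain ⟨i₁, hi₁⟩ := hv
    -- At the smallest coordinate $-v_i$ is an admissible $A$. Since $v_i<-M\le v'_i$, the element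
    -- $u$ has nonzero valuation there, and its valuation vector is the relation to which the
    -- estimate is applied.
    obtain ⟨i, -, hi⟩ := Finset.exists_min_image Finset.univ v ⟨i₁, Finset.mem_univ _⟩
    have hiM : v i < -M := (hi i₁ (Finset.mem_univ _)).trans_lt hi₁
    refine ⟨-v i, by omega, fun j => by have := hi j (Finset.mem_univ _); omega, hsum,
      ENNReal.ofReal_le_ofReal ?_⟩
    have hli : ordVec (u : Fin n → kˣ) i ≠ 0 := by
      intro h
      have h2 := congrFun hu i
      rw [Pi.add_apply, h] at h2
      have := hv' i
      omega
    refine (hC i _ hrel hli v).trans ?_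
    gcongr
    have h1 : C i ≤ ∑ i, C i := Finset.single_le_sum (fun i _ => hC0 i) (Finset.mem_univ i)
    have h2 : 0 ≤ D * decayBase ^ (-M) := by positivity
    linarith

/-- This is the absolute convergence needed for Fubini with a truncated kernel. No oscillation
enters: only shells with coordinates at least $-M'$ meet the truncated fibre. -/
theorem lintegral_fibreMeasure_polydisc_lt_top {ν : Fin r → ℤ} (hν : ∀ i, ∑ j, ν j * w i j = 1)
    (mn : Measure (Fin n → kˣ)) [mn.IsHaarMeasure] (R R' : ℝ) :
    ∫⁻ x in polydisc R, fibreMeasure w mU (dualMap w x) (polydisc R') ∂(plusMeasure mn) < ⊤ := by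
  obtain ⟨M, hM0, hM⟩ := exists_polydisc_subset (k := k) (n := n) R
  obtain ⟨M', hM'0, hM'⟩ := exists_polydisc_subset (k := k) (n := n) R'
  have hmeas : ∀ v, Measurable fun x : Fin n → kˣ =>
      fibreMeasure w mU (dualMap w x) (polydisc R' ∩ shell k v) := fun v =>
    ((Measure.measurable_coe ((measurableSet_polydisc R').inter (measurableSet_shell v))).comp
      (measurable_fibreMeasure w mU)).comp (measurable_dualMap w)
  set D : ℝ := mU.real (kerUnits k w) * mn.real (shell k (n := n) 0) with hD
  have hD0 : 0 ≤ D := mul_nonneg measureReal_nonneg measureReal_nonneg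
  have hDe : ENNReal.ofReal D = mU (kerUnits k w) * mn (shell k (n := n) 0) := by
    rw [hD, ENNReal.ofReal_mul measureReal_nonneg, ofReal_measureReal (kerUnits_lt_top w mU).ne,
      ofReal_measureReal (isCompact_shell 0).measure_lt_top.ne]
  -- The base $1/2$ is arbitrary: only $A=M'$ occurs, and the constant compensates its power.
  have h := lintegral_polydisc_tsum_lt_top mn hmeas (θ := 1 / 2) (c := D * (1 / 2) ^ (-M')) (by norm_num)
    (by norm_num) (by positivity) hM0 hM (fun v v' hv' => ?_)
  · refine lt_of_le_of_lt (lintegral_mono fun x => ?_) h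
    have hcover : (polydisc R' : Set (Fin n → kˣ)) = ⋃ v, (polydisc R' ∩ shell k v) := by
      rw [← Set.inter_iUnion, iUnion_shell, Set.inter_univ]
    conv_lhs => rw [hcover]
    exact measure_iUnion_le _
  · by_cases hu : (∃ u : (dualMap (k := k) w).ker, ordVec (u : Fin n → kˣ) + v' = v) ∧ ∀ i, -M' ≤ v i
    · right
      obtain ⟨⟨u, hu⟩, hv⟩ := hu
      refine ⟨M', hM'0, hv, sum_eq_of_ordVec_add w hν hu, ?_⟩
      rw [mul_assoc, ← zpow_add₀ (by norm_num), neg_add_cancel, zpow_zero, mul_one, hDe]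
      calc ∫⁻ x in shell k v', fibreMeasure w mU (dualMap w x) (polydisc R' ∩ shell k v) ∂mn
          ≤ ∫⁻ x in shell k v', mU (kerUnits k w) ∂mn := by
            refine lintegral_mono fun x => ?_
            exact (measure_mono Set.inter_subset_right).trans (fibreMeasure_shell_le w mU v x)
        _ = _ := by rw [setLIntegral_const, measure_shell mn v']
    · left
      rw [← lintegral_indicator (measurableSet_shell v')]
      refine (lintegral_congr fun x => ?_).trans lintegral_zero
      by_cases hx : x ∈ shell k v'
      · rw [Set.indicator_of_mem hx]
        by_cases hu1 : ∃ u : (dualMap (k := k) w).ker, ordVec (u : Fin n → kˣ) + v' = v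
        · have hempty : (polydisc R' ∩ shell k v : Set (Fin n → kˣ)) = ∅ := by
            ext y
            simp only [Set.mem_inter_iff, Set.mem_empty_iff_false, iff_false, not_and]
            intro hy hy'
            refine hu ⟨hu1, fun i => ?_⟩
            rw [← mem_shell.1 hy']
            exact hM' y hy i
          rw [hempty, measure_empty]
        · refine measure_mono_null Set.inter_subset_right
            (fibreMeasure_shell_eq_zero w mU (by rwa [mem_shell.1 hx]))
      · rw [Set.indicator_of_notMem hx]

end Absolute

/-! ### Almost everywhere convergence of the principal value. -/

section PrincipalValue

open scoped NNReal ENNReal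

variable {k : Type*} [NontriviallyNormedField k] [IsUltrametricDist k] [LocallyCompactSpace k]
variable {n r : ℕ} (w : Fin n → Fin r → ℤ) {ψ : AddChar k Circle}
variable [MeasurableSpace k] [BorelSpace k]
variable (mU : Measure (dualMap (k := k) w).ker)

variable (ψ) in
/-- The principal value of the integral of `h_ψ` over a fibre, as a sum over shells. -/
def pvKernel (t : Fin r → kˣ) : ℂ := ∑' v, shellIntegral w ψ mU v t

theorem truncKernel_of_notMem {t : Fin r → kˣ} (ht : t ∉ Set.range (dualMap (k := k) w)) (R : ℝ) :
    truncKernel w ψ mU R t = 0 := by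
  rw [truncKernel, fibreMeasure_of_notMem w mU ht]
  simp

theorem torusKernel_of_notMem {t : Fin r → kˣ} (ht : t ∉ Set.range (dualMap (k := k) w)) :
    torusKernel w ψ mU t = 0 := by
  rw [torusKernel]
  simp_rw [truncKernel_of_notMem w mU ht]
  exact tendsto_const_nhds.limUnder_eq

variable [mU.IsHaarMeasure]

open Classical in
theorem truncKernel_eq_tsum (hψ : Continuous ψ) {ν : Fin r → ℤ} (hν : ∀ i, ∑ j, ν j * w i j = 1)
    (R : ℝ) (t : Fin r → kˣ) : truncKernel w ψ mU R t =
      ∑' v : Fin n → ℤ, if ∀ i, ‖(unif k : k)‖ ^ v i ≤ R then shellIntegral w ψ mU v t else 0 := by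
  have hcover : (polydisc R : Set (Fin n → kˣ)) = ⋃ v, (polydisc R ∩ shell k v) := by
    rw [← Set.inter_iUnion, iUnion_shell, Set.inter_univ]
  have hint : IntegrableOn (hPsi ψ) (polydisc R) (fibreMeasure w mU t) :=
    Measure.integrableOn_of_bounded (fibreMeasure_polydisc_lt_top w mU hν R t).ne
      (M := 1) (measurable_hPsi hψ).aestronglyMeasurable (ae_of_all _ fun x => (norm_hPsi x).le)
  have h := integral_iUnion (f := hPsi ψ) (μ := fibreMeasure w mU t)
    (s := fun v => (polydisc R ∩ shell k v : Set (Fin n → kˣ)))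
    (fun v => (measurableSet_polydisc R).inter (measurableSet_shell v))
    (fun v v' hne => (pairwise_disjoint_shell hne).mono Set.inter_subset_right Set.inter_subset_right)
    (by rw [← hcover]; exact hint)
  rw [← hcover] at h
  refine h.trans (tsum_congr fun v => ?_)
  split_ifs with hv
  · rw [shellIntegral, Set.inter_eq_right.2]
    intro x hx i
    rw [norm_eq_zpow_ord, ← ordVec_apply, mem_shell.1 hx]
    exact hv i
  · have : (polydisc R ∩ shell k v : Set (Fin n → kˣ)) = ∅ := by
      ext x
      simp only [Set.mem_inter_iff, Set.mem_empty_iff_false, iff_false, not_and]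
      intro hx hx'
      refine hv fun i => ?_
      rw [← mem_shell.1 hx', ordVec_apply, ← norm_eq_zpow_ord]
      exact hx i
    rw [this]
    simp

theorem enorm_truncKernel_le (hψ : Continuous ψ) {ν : Fin r → ℤ} (hν : ∀ i, ∑ j, ν j * w i j = 1)
    (R : ℝ) (t : Fin r → kˣ) : ‖truncKernel w ψ mU R t‖ₑ ≤ absKernel w ψ mU t := by
  classical
  rw [truncKernel_eq_tsum w mU hψ hν]
  refine enorm_tsum_le_tsum_enorm.trans (ENNReal.tsum_le_tsum fun v => ?_)
  split_ifs
  · exact le_rfl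
  · simp

theorem enorm_pvKernel_le (t : Fin r → kˣ) : ‖pvKernel w ψ mU t‖ₑ ≤ absKernel w ψ mU t :=
  enorm_tsum_le_tsum_enorm

/-- A polydisc is a union of whole shells, so truncation selects terms of an absolutely convergent
series, and each term is eventually selected. -/
theorem tendsto_truncKernel (hψ : Continuous ψ) {ν : Fin r → ℤ} (hν : ∀ i, ∑ j, ν j * w i j = 1)
    {t : Fin r → kˣ} (ht : absKernel w ψ mU t < ⊤) :
    Tendsto (fun R : ℝ => truncKernel w ψ mU R t) atTop (𝓝 (pvKernel w ψ mU t)) := by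
  classical
  simp_rw [truncKernel_eq_tsum w mU hψ hν]
  have hs : Summable fun v => ‖shellIntegral w ψ mU v t‖ := by
    have := ENNReal.summable_toReal ht.ne
    simpa using this
  refine tendsto_tsum_of_dominated_convergence hs (fun v => ?_) (Eventually.of_forall fun R v => ?_)
  · refine tendsto_const_nhds.congr' ?_
    have : ∀ᶠ R : ℝ in atTop, ∀ i, ‖(unif k : k)‖ ^ v i ≤ R :=
      eventually_all.2 fun i => eventually_ge_atTop _
    filter_upwards [this] with R hR
    rw [if_pos hR]
  · split_ifs <;> simp

theorem torusKernel_eq_pvKernel (hψ : Continuous ψ) {ν : Fin r → ℤ} (hν : ∀ i, ∑ j, ν j * w i j = 1)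
    {t : Fin r → kˣ} (ht : absKernel w ψ mU t < ⊤) : torusKernel w ψ mU t = pvKernel w ψ mU t :=
  (tendsto_truncKernel w mU hψ hν ht).limUnder_eq

theorem stronglyMeasurable_truncKernel (hψ : Continuous ψ) (R : ℝ) :
    StronglyMeasurable (truncKernel w ψ mU R) := by
  have h : StronglyMeasurable ((polydisc R).indicator (hPsi ψ : (Fin n → kˣ) → ℂ)) :=
    ((measurable_hPsi hψ).indicator (measurableSet_polydisc R)).stronglyMeasurable
  have := h.integral_kernel (κ := fibreKernel w mU)
  simp_rw [integral_indicator (measurableSet_polydisc R), fibreKernel_apply] at this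
  exact this

theorem measurable_pvKernel (hψ : Continuous ψ) : Measurable (pvKernel w ψ mU) :=
  Measurable.tsum fun v => (measurable_shellIntegral w mU hψ v).measurable

theorem absolutelyContinuous_plusMeasure (mn : Measure (Fin n → kˣ)) : mn ≪ plusMeasure mn :=
  withDensity_absolutelyContinuous' measurable_prodAbs.coe_nnreal_ennreal.aemeasurable
    (ae_of_all _ fun x => by simpa using (prodAbs_pos x).ne')

theorem plusMeasure_absolutelyContinuous (mn : Measure (Fin n → kˣ)) : plusMeasure mn ≪ mn :=
  withDensity_absolutelyContinuous _ _

theorem ae_absKernel_lt_top [CharZero k] (hψ : Continuous ψ) (hψ1 : ψ ≠ 1)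
    {ν : Fin r → ℤ} (hν : ∀ i, ∑ j, ν j * w i j = 1)
    (mn : Measure (Fin n → kˣ)) [mn.IsHaarMeasure] :
    ∀ᵐ x ∂mn, absKernel w ψ mU (dualMap w x) < ⊤ := by
  refine (absolutelyContinuous_plusMeasure mn).ae_le ?_
  -- Integrability is local, over polydiscs; countably many of them cover $T_n(k)$.
  have h : ∀ᵐ x ∂(plusMeasure mn), ∀ N : ℕ, x ∈ polydisc (N : ℝ) → absKernel w ψ mU (dualMap w x) < ⊤ := by
    refine ae_all_iff.2 fun N => ?_
    refine (ae_restrict_iff' (measurableSet_polydisc _)).1 ?_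
    exact ae_lt_top ((measurable_absKernel w mU hψ).comp (measurable_dualMap w))
      (lintegral_absKernel_lt_top w mU hψ hψ1 hν mn N).ne
  filter_upwards [h] with x hx
  obtain ⟨N, hN⟩ := exists_nat_ge ‖coords x‖
  exact hx N fun i => (norm_le_pi_norm (coords x) i).trans hN

end PrincipalValue

/-! ### Standard Schwartz functions and their Fourier transforms. -/

section StandardFourier

open scoped NNReal ENNReal

variable {k : Type*} [NontriviallyNormedField k] [IsUltrametricDist k] [LocallyCompactSpace k]
variable {n : ℕ} {ψ : AddChar k Circle}

/-- The number $\delta$ is a Lebesgue number for the cover of the compact support by the level sets.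
A translation leading into the support from outside is read backwards. -/
theorem exists_translation_invariant {Φ : (Fin n → k) → ℂ} (h1 : IsLocallyConstant Φ)
    (h2 : HasCompactSupport Φ) : ∃ δ : ℝ, 0 < δ ∧ ∀ z c, ‖c‖ < δ → Φ (z + c) = Φ z := by
  obtain ⟨δ, hδ, h⟩ := lebesgue_number_lemma_of_metric (c := fun a : ℂ => Φ ⁻¹' {a}) h2
    (fun a => h1.isOpen_fiber a) (fun z _ => Set.mem_iUnion.2 ⟨Φ z, rfl⟩)
  have key : ∀ z ∈ tsupport Φ, ∀ z', dist z' z < δ → Φ z' = Φ z := by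
    intro z hz z' hz'
    obtain ⟨a, ha⟩ := h z hz
    have e1 : Φ z' = a := ha hz'
    have e2 : Φ z = a := ha (Metric.mem_ball_self hδ)
    rw [e1, e2]
  refine ⟨δ, hδ, fun z c hc => ?_⟩
  by_cases hz : z ∈ tsupport Φ
  · exact key z hz _ (by simpa [dist_eq_norm] using hc)
  · by_cases hz' : z + c ∈ tsupport Φ
    · exact (key _ hz' z (by simpa [dist_eq_norm] using hc)).symm
    · rw [image_eq_zero_of_notMem_tsupport hz, image_eq_zero_of_notMem_tsupport hz']

theorem IsStdSchwartz.continuous {φ : (Fin n → kˣ) → ℂ} (hφ : IsStdSchwartz φ) : Continuous φ := by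
  obtain ⟨Φ, h1, -, h⟩ := hφ
  have : φ = Φ ∘ coords := funext h
  rw [this]
  exact h1.continuous.comp isOpenEmbedding_coords.continuous

theorem IsStdSchwartz.exists_bound {φ : (Fin n → kˣ) → ℂ} (hφ : IsStdSchwartz φ) :
    ∃ B R : ℝ, 0 ≤ B ∧ 0 ≤ R ∧ (∀ x, ‖φ x‖ ≤ B) ∧ ∀ x, φ x ≠ 0 → x ∈ polydisc R := by
  obtain ⟨Φ, h1, h2, h⟩ := hφ
  obtain ⟨B, hB⟩ := h2.exists_bound_of_continuous h1.continuous
  obtain ⟨R, hR⟩ := h2.isBounded.exists_norm_le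
  refine ⟨B, max R 0, (norm_nonneg _).trans (hB 0), le_max_right _ _, fun x => by rw [h]; exact hB _,
    fun x hx i => ?_⟩
  rw [h] at hx
  exact (norm_le_pi_norm (coords x) i).trans
    ((hR _ (subset_tsupport _ hx)).trans (le_max_left _ _))

variable [MeasurableSpace k] [BorelSpace k]

theorem plusMeasure_polydisc_lt_top (mn : Measure (Fin n → kˣ)) [mn.IsHaarMeasure] (R : ℝ) :
    plusMeasure mn (polydisc R) < ⊤ := by
  have hsub : (polydisc R : Set (Fin n → kˣ)) ⊆ coords ⁻¹' Metric.closedBall 0 (max R 0) := by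
    intro x hx
    rw [Set.mem_preimage, mem_closedBall_zero_iff, pi_norm_le_iff_of_nonneg (le_max_right _ _)]
    exact fun i => (hx i).trans (le_max_left _ _)
  refine (measure_mono hsub).trans_lt ?_
  obtain ⟨c, hc⟩ := exists_map_coords_plusMeasure mn
  rw [← measurableEmbedding_coords.map_apply, hc, Measure.smul_apply, ENNReal.smul_def, smul_eq_mul]
  exact ENNReal.mul_lt_top ENNReal.coe_lt_top measure_closedBall_lt_top

theorem integrable_of_polydisc {μ : Measure (Fin n → kˣ)} {R B : ℝ} (hμ : μ (polydisc R) < ⊤)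
    {f : (Fin n → kˣ) → ℂ} (hf : Measurable f) (hB : ∀ x, ‖f x‖ ≤ B) (hR : ∀ x, f x ≠ 0 → x ∈ polydisc R) :
    Integrable f μ := by
  rw [← integrableOn_iff_integrable_of_support_subset (s := polydisc R) hR]
  exact Measure.integrableOn_of_bounded hμ.ne (M := B) hf.aestronglyMeasurable (ae_of_all _ hB)

theorem stdFourier_eq (mn : Measure (Fin n → kˣ)) (φ : (Fin n → kˣ) → ℂ) (x : Fin n → kˣ) :
    stdFourier ψ mn φ x = ∫ y, hPsi ψ (x * y) * φ y ∂(plusMeasure mn) := by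
  rw [stdFourier, integral_plusMeasure]
  refine integral_congr_ae (ae_of_all _ fun y => ?_)
  change _ * ((prodAbs y : ℝ) : ℂ) = _
  exact mul_comm _ _

instance sFinite_plusMeasure (mn : Measure (Fin n → kˣ)) [mn.IsHaarMeasure] : SFinite (plusMeasure mn) := by
  unfold plusMeasure; infer_instance

theorem measurable_stdFourier (hψ : Continuous ψ) (mn : Measure (Fin n → kˣ)) [mn.IsHaarMeasure]
    {φ : (Fin n → kˣ) → ℂ} (hφ : Measurable φ) : Measurable (stdFourier ψ mn φ) := by
  have : stdFourier ψ mn φ = fun x => ∫ y, hPsi ψ (x * y) * φ y ∂(plusMeasure mn) :=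
    funext fun x => stdFourier_eq mn φ x
  rw [this]
  refine StronglyMeasurable.measurable (StronglyMeasurable.integral_prod_right
    (f := fun x y => hPsi ψ (x * y) * φ y) ?_)
  refine Measurable.stronglyMeasurable (Measurable.mul ?_ (hφ.comp measurable_snd))
  exact (measurable_hPsi hψ).comp (by fun_prop)

/-- The truncations of the integral defining the Fourier transform of a Schwartz function agree
with it from some point on, uniformly, and the Fourier transform has bounded support. -/
theorem IsStdSchwartz.exists_fourier (hψ1 : ψ ≠ 1) (mn : Measure (Fin n → kˣ)) [mn.IsHaarMeasure]
    {φ : (Fin n → kˣ) → ℂ} (hφ : IsStdSchwartz φ) :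
    ∃ L R₁ : ℝ, (∀ x, stdFourier ψ mn φ x ≠ 0 → x ∈ polydisc L) ∧
      ∀ R ≥ R₁, ∀ x, ∫ y, (polydisc R).indicator (hPsi ψ) (x * y) * φ y ∂(plusMeasure mn) =
        stdFourier ψ mn φ x := by
  obtain ⟨c₀, hc₀⟩ := DFunLike.ne_iff.1 hψ1
  obtain ⟨B, R₀, hB0, hR₀, -, hsupp⟩ := hφ.exists_bound
  obtain ⟨Φ, h1, h2, h⟩ := hφ
  obtain ⟨δ, hδ, hinv⟩ := exists_translation_invariant h1 h2
  have hζ : (ψ c₀ : ℂ) ≠ 1 := fun h => hc₀ (Circle.ext (by simpa using h))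
  set L : ℝ := ‖c₀‖ / δ with hL
  have hL0 : 0 ≤ L := div_nonneg (norm_nonneg _) hδ.le
  -- When $|x_i|>L$ the translation by $c_0/x_i$ in the $i$-th coordinate is too short to change
  -- $\Phi$ but multiplies the character by $\psi(c_0)\neq1$. The predicate $Q$ lets the full and
  -- the truncated integral be treated at once.
  have key : ∀ (x : Fin n → kˣ) (i : Fin n) (hi : L < ‖(x i : k)‖) (Q : (Fin n → k) → Prop)
      (hQ : ∀ z, Q (z + Pi.single i (c₀ / (x i : k))) ↔ Q z),
      ∫ y, {z | Q z}.indicator (fun z => (ψ (∑ j, (x j : k) * z j) : ℂ) * Φ z) (coords y)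
        ∂(plusMeasure mn) = 0 := by
    intro x i hi Q hQ
    refine integral_plusMeasure_eq_zero mn _ (Pi.single i (c₀ / (x i : k))) hζ fun z => ?_
    have hc : ‖(Pi.single i (c₀ / (x i : k)) : Fin n → k)‖ < δ := by
      rw [Pi.norm_single, norm_div, div_lt_iff₀ (norm_pos_iff.2 (x i).ne_zero)]
      rw [hL, div_lt_iff₀ hδ] at hi
      linarith
    have hsum : ∑ j, (x j : k) * (z + (Pi.single i (c₀ / (x i : k)) : Fin n → k)) j = c₀ + ∑ j, (x j : k) * z j := by
      simp_rw [Pi.add_apply, mul_add, Finset.sum_add_distrib]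
      rw [add_comm]
      congr 1
      rw [Finset.sum_eq_single i]
      · rw [Pi.single_eq_same, mul_div_cancel₀ _ (x i).ne_zero]
      · intro j _ hj
        rw [Pi.single_eq_of_ne hj, mul_zero]
      · simp
    by_cases hz : Q z
    · rw [Set.indicator_of_mem (by exact (hQ z).2 hz), Set.indicator_of_mem (by exact hz), hsum, hinv z _ hc,
        AddChar.map_add_eq_mul, Circle.coe_mul, mul_assoc]
    · rw [Set.indicator_of_notMem (by exact fun h => hz ((hQ z).1 h)), Set.indicator_of_notMem (by exact hz),
        mul_zero]
  have hzero : ∀ (x : Fin n → kˣ) (i : Fin n), L < ‖(x i : k)‖ → stdFourier ψ mn φ x = 0 := by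
    intro x i hi
    rw [stdFourier_eq, ← key x i hi (fun _ => True) (fun z => Iff.rfl)]
    refine integral_congr_ae (ae_of_all _ fun y => ?_)
    simp only [h]
    rw [Set.indicator_of_mem (by trivial)]
    rfl
  -- If some $|x_i|>L$, then $R\ge|c_0|$ makes the truncation invariant under the translation, so
  -- both integrals vanish. Otherwise $R\ge LR_0$ makes the truncation void on the support of
  -- $\phi$.
  refine ⟨L, max ‖c₀‖ (L * R₀), fun x hx i => ?_, fun R hR x => ?_⟩
  · by_contra hi
    exact hx (hzero x i (not_le.1 hi))
  · by_cases hx : ∃ i, L < ‖(x i : k)‖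
    · obtain ⟨i, hi⟩ := hx
      rw [hzero x i hi, ← key x i hi (fun z => ∀ j, ‖(x j : k) * z j‖ ≤ R) (fun z => ?_)]
      · refine integral_congr_ae (ae_of_all _ fun y => ?_)
        simp only [h]
        by_cases hy : x * y ∈ polydisc R
        · rw [Set.indicator_of_mem hy, Set.indicator_of_mem (by exact hy)]
          rfl
        · rw [Set.indicator_of_notMem hy, Set.indicator_of_notMem (by exact hy), zero_mul]
      · refine forall_congr' fun j => ?_
        by_cases hj : j = i
        · subst hj
          have hcR : ‖c₀‖ ≤ R := (le_max_left _ _).trans hR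
          rw [Pi.add_apply, Pi.single_eq_same, mul_add, mul_div_cancel₀ _ (x j).ne_zero]
          constructor
          · intro h
            have e : (x j : k) * z j = ((x j : k) * z j + c₀) + -c₀ := by ring
            rw [e]
            exact (IsUltrametricDist.norm_add_le_max _ _).trans (max_le h (by rwa [norm_neg]))
          · intro h
            exact (IsUltrametricDist.norm_add_le_max _ _).trans (max_le h hcR)
        · rw [Pi.add_apply, Pi.single_eq_of_ne hj, add_zero]
    · push Not at hx
      rw [stdFourier_eq]
      refine integral_congr_ae (ae_of_all _ fun y => ?_)
      by_cases hy : φ y = 0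
      · simp [hy]
      · have hm : x * y ∈ polydisc R := by
          intro i
          rw [Pi.mul_apply, Units.val_mul, norm_mul]
          exact (mul_le_mul (hx i) (hsupp y hy i) (norm_nonneg _) hL0).trans ((le_max_right _ _).trans hR)
        simp only [Set.indicator_of_mem hm]

end StandardFourier

/-! ### Fubini for the truncated kernels, passage to the limit, and descent to $T(k)$. -/

section Intertwining

open scoped NNReal ENNReal

variable {k : Type*} [NontriviallyNormedField k] [IsUltrametricDist k] [LocallyCompactSpace k]
variable {n r : ℕ}

theorem exists_mul_mem_polydisc (y : Fin n → kˣ) (R : ℝ) :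
    ∃ R' : ℝ, ∀ x : Fin n → kˣ, y * x ∈ polydisc R → x ∈ polydisc R' := by
  refine ⟨‖coords y⁻¹‖ * R, fun x hx i => ?_⟩
  have e : ((x i : kˣ) : k) = coords y⁻¹ i * (((y * x) i : kˣ) : k) := by
    simp [coords]
  rw [e, norm_mul]
  exact mul_le_mul (norm_le_pi_norm (coords y⁻¹) i) (hx i) (norm_nonneg _) (norm_nonneg _)

variable [MeasurableSpace k] [BorelSpace k]

theorem integrable_plusMeasure_iff (mn : Measure (Fin n → kˣ)) {f : (Fin n → kˣ) → ℂ} :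
    Integrable f (plusMeasure mn) ↔ Integrable (fun x => (prodAbs x : ℂ) * f x) mn := by
  rw [plusMeasure, integrable_withDensity_iff_integrable_smul measurable_prodAbs]
  refine integrable_congr (ae_of_all _ fun x => ?_)
  simp [NNReal.smul_def]

variable (w : Fin n → Fin r → ℤ) {ψ : AddChar k Circle}
variable (mU : Measure (dualMap (k := k) w).ker)

theorem pushforward_of_notMem (f : (Fin n → kˣ) → ℂ) {t : Fin r → kˣ}
    (ht : t ∉ Set.range (dualMap (k := k) w)) : pushforward w mU f t = 0 := by
  rw [pushforward, fibreMeasure_of_notMem w mU ht, integral_zero_measure]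

theorem mul_mem_range_iff {t s : Fin r → kˣ} (ht : t ∈ Set.range (dualMap (k := k) w)) :
    t * s ∈ Set.range (dualMap (k := k) w) ↔ s ∈ Set.range (dualMap (k := k) w) := by
  rw [← MonoidHom.coe_range] at *
  exact Subgroup.mul_mem_cancel_left _ ht

theorem mul_notMem_range {t s : Fin r → kˣ} (ht : t ∉ Set.range (dualMap (k := k) w))
    (hs : s ∈ Set.range (dualMap (k := k) w)) : t * s ∉ Set.range (dualMap (k := k) w) := by
  rw [← MonoidHom.coe_range] at *
  exact fun h => ht ((Subgroup.mul_mem_cancel_right _ hs).1 h)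

variable [mU.IsHaarMeasure]

theorem pushforward_translate {f : (Fin n → kˣ) → ℂ} (hf : Measurable f) (y : Fin n → kˣ)
    (s : Fin r → kˣ) : pushforward w mU f ((dualMap w y)⁻¹ * s) =
      pushforward w mU (fun x => f (y⁻¹ * x)) s := by
  by_cases hs : s ∈ Set.range (dualMap (k := k) w)
  · obtain ⟨x, rfl⟩ := hs
    have hf2 : Measurable fun x => f (y⁻¹ * x) := hf.comp (measurable_const_mul _)
    rw [← map_inv, ← map_mul, pushforward, pushforward, integral_fibreMeasure w mU _ hf,
      integral_fibreMeasure w mU _ hf2]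
    refine integral_congr_ae (ae_of_all _ fun u => ?_)
    simp only
    congr 1
    exact mul_left_comm _ _ _
  · rw [pushforward_of_notMem w mU _ hs, pushforward_of_notMem]
    rw [mul_mem_range_iff w ⟨y⁻¹, map_inv _ _⟩]
    exact hs

variable (mn : Measure (Fin n → kˣ)) [mn.IsHaarMeasure]

theorem lintegral_plusMeasure_mul_left (y : Fin n → kˣ) {f : (Fin n → kˣ) → ℝ≥0∞} (hf : Measurable f) :
    ∫⁻ x, f (y * x) ∂(plusMeasure mn) = (((prodAbs y)⁻¹ : ℝ≥0) : ℝ≥0∞) * ∫⁻ x, f x ∂(plusMeasure mn) := by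
  have hf2 : Measurable fun x => f (y * x) := hf.comp (measurable_const_mul y)
  have hp := (measurable_prodAbs (k := k) (n := n)).coe_nnreal_ennreal
  rw [plusMeasure, lintegral_withDensity_eq_lintegral_mul _ hp hf2, lintegral_withDensity_eq_lintegral_mul _ hp hf,
    ← lintegral_const_mul _ (hp.mul hf),
    ← lintegral_mul_left_eq_self (fun x => (((prodAbs y)⁻¹ : ℝ≥0) : ℝ≥0∞) * _) y]
  refine lintegral_congr fun x => ?_
  simp only [Pi.mul_apply]
  rw [prodAbs_mul, ← mul_assoc, ← ENNReal.coe_mul, inv_mul_cancel_left₀ (prodAbs_pos y).ne']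

theorem lintegral_absKernel_mul_lt_top [CharZero k] (hψ : Continuous ψ) (hψ1 : ψ ≠ 1)
    {ν : Fin r → ℤ} (hν : ∀ i, ∑ j, ν j * w i j = 1) {φ : (Fin n → kˣ) → ℂ} (hφ : IsStdSchwartz φ)
    (y : Fin n → kˣ) :
    ∫⁻ x, absKernel w ψ mU (dualMap w (y * x)) * ‖φ x‖ₑ ∂(plusMeasure mn) < ⊤ := by
  obtain ⟨B, R, hB0, hR0, hB, hR⟩ := hφ.exists_bound
  obtain ⟨R', hR'⟩ := exists_mul_mem_polydisc y⁻¹ R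
  have hm : Measurable fun x : Fin n → kˣ => absKernel w ψ mU (dualMap w x) :=
    (measurable_absKernel w mU hψ).comp (measurable_dualMap w)
  have hm2 : Measurable ((polydisc R').indicator fun x : Fin n → kˣ => absKernel w ψ mU (dualMap w x)) :=
    hm.indicator (measurableSet_polydisc R')
  calc ∫⁻ x, absKernel w ψ mU (dualMap w (y * x)) * ‖φ x‖ₑ ∂(plusMeasure mn)
      ≤ ∫⁻ x, ENNReal.ofReal B * (polydisc R').indicator
          (fun x => absKernel w ψ mU (dualMap w x)) (y * x) ∂(plusMeasure mn) := by
        refine lintegral_mono fun x => ?_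
        by_cases hx : φ x = 0
        · simp [hx]
        · have hmem : y * x ∈ polydisc R' := hR' _ (by rw [inv_mul_cancel_left]; exact hR x hx)
          rw [Set.indicator_of_mem hmem, mul_comm]
          refine mul_le_mul_left ?_ _
          rw [← ofReal_norm]
          exact ENNReal.ofReal_le_ofReal (hB x)
    _ = ENNReal.ofReal B * ((((prodAbs y)⁻¹ : ℝ≥0) : ℝ≥0∞) *
          ∫⁻ x in polydisc R', absKernel w ψ mU (dualMap w x) ∂(plusMeasure mn)) := by
        have hm3 : Measurable fun x => (polydisc R').indicator
            (fun x : Fin n → kˣ => absKernel w ψ mU (dualMap w x)) (y * x) :=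
          hm2.comp (measurable_const_mul y)
        rw [lintegral_const_mul _ hm3, lintegral_plusMeasure_mul_left mn y hm2,
          lintegral_indicator (measurableSet_polydisc R')]
    _ < ⊤ := ENNReal.mul_lt_top ENNReal.ofReal_lt_top (ENNReal.mul_lt_top ENNReal.coe_lt_top
        (lintegral_absKernel_lt_top w mU hψ hψ1 hν mn R'))

theorem ae_absKernel_mul_lt_top [CharZero k] (hψ : Continuous ψ) (hψ1 : ψ ≠ 1)
    {ν : Fin r → ℤ} (hν : ∀ i, ∑ j, ν j * w i j = 1) (y : Fin n → kˣ) :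
    ∀ᵐ x ∂mn, absKernel w ψ mU (dualMap w (y * x)) < ⊤ :=
  (measurePreserving_mul_left mn y).quasiMeasurePreserving.ae (ae_absKernel_lt_top w mU hψ hψ1 hν mn)

theorem integrable_pvKernel_mul [CharZero k] (hψ : Continuous ψ) (hψ1 : ψ ≠ 1)
    {ν : Fin r → ℤ} (hν : ∀ i, ∑ j, ν j * w i j = 1) {φ : (Fin n → kˣ) → ℂ} (hφ : IsStdSchwartz φ)
    (y : Fin n → kˣ) :
    Integrable (fun x => pvKernel w ψ mU (dualMap w (y * x)) * φ x) (plusMeasure mn) := by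
  refine ⟨?_, (lintegral_mono fun x => ?_).trans_lt (lintegral_absKernel_mul_lt_top w mU mn hψ hψ1 hν hφ y)⟩
  · exact ((((measurable_pvKernel w mU hψ).comp (measurable_dualMap w)).comp (measurable_const_mul y)).mul
      hφ.continuous.measurable).aestronglyMeasurable
  · rw [enorm_mul]
    exact mul_le_mul_left (enorm_pvKernel_le w mU _) _

/-- Integrating the kernel against a Schwartz function is a limit of integrals of truncations. -/
theorem tendsto_integral_truncKernel [CharZero k] (hψ : Continuous ψ) (hψ1 : ψ ≠ 1)
    {ν : Fin r → ℤ} (hν : ∀ i, ∑ j, ν j * w i j = 1) {φ : (Fin n → kˣ) → ℂ} (hφ : IsStdSchwartz φ)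
    (y : Fin n → kˣ) :
    Tendsto (fun N : ℕ => ∫ x, truncKernel w ψ mU N (dualMap w (y * x)) * φ x ∂(plusMeasure mn)) atTop
      (𝓝 (∫ x, pvKernel w ψ mU (dualMap w (y * x)) * φ x ∂(plusMeasure mn))) := by
  have hae : ∀ᵐ x ∂(plusMeasure mn), absKernel w ψ mU (dualMap w (y * x)) < ⊤ :=
    (plusMeasure_absolutelyContinuous mn).ae_le (ae_absKernel_mul_lt_top w mU mn hψ hψ1 hν y)
  have hdm : Measurable fun x : Fin n → kˣ => dualMap w (y * x) :=
    (measurable_dualMap w).comp (measurable_const_mul y)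
  refine tendsto_integral_of_dominated_convergence
    (fun x => (absKernel w ψ mU (dualMap w (y * x))).toReal * ‖φ x‖) (fun N => ?_) ?_ (fun N => ?_) ?_
  · exact (((stronglyMeasurable_truncKernel w mU hψ N).measurable.comp hdm).mul
      hφ.continuous.measurable).aestronglyMeasurable
  · refine ⟨((((measurable_absKernel w mU hψ).comp hdm).ennreal_toReal).mul
      hφ.continuous.measurable.norm).aestronglyMeasurable, (lintegral_mono fun x => ?_).trans_lt
      (lintegral_absKernel_mul_lt_top w mU mn hψ hψ1 hν hφ y)⟩
    rw [enorm_mul, enorm_norm]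
    refine mul_le_mul_left ?_ _
    rw [Real.enorm_eq_ofReal ENNReal.toReal_nonneg]
    exact ENNReal.ofReal_toReal_le
  · filter_upwards [hae] with x hx
    rw [norm_mul]
    refine mul_le_mul_of_nonneg_right ?_ (norm_nonneg _)
    have := ENNReal.toReal_mono hx.ne (enorm_truncKernel_le w mU hψ hν N (dualMap w (y * x)))
    simpa using this
  · filter_upwards [hae] with x hx
    exact (((tendsto_truncKernel w mU hψ hν hx).comp tendsto_natCast_atTop_atTop).mul_const _)

/-- The truncated kernel is an absolutely convergent integral over $U(k)$, so the two integrations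
may be exchanged. The integrand is supported where $x$ lies in a polydisc containing the support of
$\phi$ and $ux$ in another, which reduces the bound to volumes of truncated fibres. -/
theorem integral_truncKernel_mul (hψ : Continuous ψ)
    {ν : Fin r → ℤ} (hν : ∀ i, ∑ j, ν j * w i j = 1) {φ : (Fin n → kˣ) → ℂ} (hφ : IsStdSchwartz φ)
    (y : Fin n → kˣ) (R : ℝ) :
    ∫ x, truncKernel w ψ mU R (dualMap w (y * x)) * φ x ∂(plusMeasure mn) =
      ∫ u, (∫ x, (polydisc R).indicator (hPsi ψ) (((u : Fin n → kˣ) * y) * x) * φ x ∂(plusMeasure mn)) ∂mU := by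
  obtain ⟨B, R₀, hB0, hR0, hB, hR₀⟩ := hφ.exists_bound
  obtain ⟨R', hR'⟩ := exists_mul_mem_polydisc y R
  have hmh : Measurable ((polydisc R).indicator (hPsi ψ : (Fin n → kˣ) → ℂ)) :=
    (measurable_hPsi hψ).indicator (measurableSet_polydisc R)
  set F : (Fin n → kˣ) → (dualMap (k := k) w).ker → ℂ := fun x u =>
    (polydisc R).indicator (hPsi ψ) (((u : Fin n → kˣ) * y) * x) * φ x with hF
  have e : ∀ x, truncKernel w ψ mU R (dualMap w (y * x)) * φ x = ∫ u, F x u ∂mU := by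
    intro x
    have h1 : truncKernel w ψ mU R (dualMap w (y * x)) =
        ∫ z, (polydisc R).indicator (hPsi ψ) z ∂(fibreMeasure w mU (dualMap w (y * x))) :=
      (integral_indicator (measurableSet_polydisc R)).symm
    rw [hF, h1, integral_fibreMeasure w mU _ hmh, ← integral_mul_const]
    simp_rw [mul_assoc]
  simp_rw [e]
  refine integral_integral_swap ⟨?_, ?_⟩
  · refine (Measurable.mul (hmh.comp ?_) (hφ.continuous.measurable.comp measurable_fst)).aestronglyMeasurable
    fun_prop
  · have hFm : Measurable (Function.uncurry F) := by
      refine Measurable.mul (hmh.comp ?_) (hφ.continuous.measurable.comp measurable_fst)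
      fun_prop
    rw [HasFiniteIntegral, lintegral_prod _ hFm.enorm.aemeasurable]
    calc ∫⁻ x, ∫⁻ u, ‖Function.uncurry F (x, u)‖ₑ ∂mU ∂(plusMeasure mn)
        ≤ ∫⁻ x in polydisc R₀, ENNReal.ofReal B * fibreMeasure w mU (dualMap w x) (polydisc R') ∂(plusMeasure mn) := by
          rw [← lintegral_indicator (measurableSet_polydisc R₀)]
          refine lintegral_mono fun x => ?_
          by_cases hx : φ x = 0
          · simp [hF, Function.uncurry, hx]
          · rw [Set.indicator_of_mem (hR₀ x hx), fibreMeasure_dualMap_apply w mU x (measurableSet_polydisc R')]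
            have hS : MeasurableSet {u : (dualMap (k := k) w).ker | (u : Fin n → kˣ) * x ∈ polydisc R'} :=
              (show Measurable fun u : (dualMap (k := k) w).ker => (u : Fin n → kˣ) * x by fun_prop)
                (measurableSet_polydisc R')
            rw [← setLIntegral_const, ← lintegral_indicator hS]
            refine lintegral_mono fun u => ?_
            by_cases hu : (u : Fin n → kˣ) * x ∈ polydisc R'
            · rw [Set.indicator_of_mem (by exact hu)]
              change ‖(polydisc R).indicator (hPsi ψ) (((u : Fin n → kˣ) * y) * x) * φ x‖ₑ ≤ _
              rw [← ofReal_norm, norm_mul]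
              refine ENNReal.ofReal_le_ofReal ?_
              refine (mul_le_mul (b := 1) ?_ (hB x) (norm_nonneg _) zero_le_one).trans_eq (one_mul _)
              exact (norm_indicator_le_norm_self _ _).trans_eq (norm_hPsi _)
            · have : ((u : Fin n → kˣ) * y) * x ∉ polydisc R := by
                intro h
                refine hu (hR' _ ?_)
                rwa [← mul_assoc, mul_comm y]
              change ‖(polydisc R).indicator (hPsi ψ) (((u : Fin n → kˣ) * y) * x) * φ x‖ₑ ≤ _
              rw [Set.indicator_of_notMem this]
              simp
      _ = ENNReal.ofReal B * ∫⁻ x in polydisc R₀, fibreMeasure w mU (dualMap w x) (polydisc R') ∂(plusMeasure mn) := by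
          refine lintegral_const_mul _ ?_
          exact ((Measure.measurable_coe (measurableSet_polydisc R')).comp
            (measurable_fibreMeasure w mU)).comp (measurable_dualMap w)
      _ < ⊤ := ENNReal.mul_lt_top ENNReal.ofReal_lt_top
          (lintegral_fibreMeasure_polydisc_lt_top w mU hν mn R₀ R')

/-- The integral of the kernel against a Schwartz function is the integral over a fibre of its
Fourier transform. -/
theorem integral_pvKernel_mul [CharZero k] (hψ : Continuous ψ) (hψ1 : ψ ≠ 1)
    {ν : Fin r → ℤ} (hν : ∀ i, ∑ j, ν j * w i j = 1) {φ : (Fin n → kˣ) → ℂ} (hφ : IsStdSchwartz φ)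
    (y : Fin n → kˣ) :
    ∫ x, pvKernel w ψ mU (dualMap w (y * x)) * φ x ∂(plusMeasure mn) =
      pushforward w mU (stdFourier ψ mn φ) (dualMap w y) := by
  obtain ⟨L, R₁, -, h⟩ := hφ.exists_fourier hψ1 mn
  -- The same sequence is eventually constant, as the truncations of the Fourier integral stabilise
  -- uniformly over the fibre.
  refine tendsto_nhds_unique (tendsto_integral_truncKernel w mU mn hψ hψ1 hν hφ y) ?_
  refine tendsto_const_nhds.congr' ?_
  filter_upwards [tendsto_natCast_atTop_atTop.eventually (eventually_ge_atTop R₁)] with N hN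
  rw [integral_truncKernel_mul w mU mn hψ hν hφ y, pushforward,
    integral_fibreMeasure w mU y (measurable_stdFourier hψ mn hφ.continuous.measurable)]
  simp_rw [h N hN]

theorem integrable_stdFourier (hψ : Continuous ψ) (hψ1 : ψ ≠ 1)
    {ν : Fin r → ℤ} (hν : ∀ i, ∑ j, ν j * w i j = 1) {φ : (Fin n → kˣ) → ℂ} (hφ : IsStdSchwartz φ)
    (t : Fin r → kˣ) : Integrable (stdFourier ψ mn φ) (fibreMeasure w mU t) := by
  obtain ⟨L, R₁, h, -⟩ := hφ.exists_fourier hψ1 mn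
  refine integrable_of_polydisc (B := ∫ y, ‖φ y‖ ∂(plusMeasure mn)) (fibreMeasure_polydisc_lt_top w mU hν L t)
    (measurable_stdFourier hψ mn hφ.continuous.measurable) (fun x => ?_) h
  rw [stdFourier_eq]
  refine (norm_integral_le_integral_norm _).trans_eq ?_
  simp

theorem stdKernel_mul_check (φ : (Fin n → kˣ) → ℂ) (x y : Fin n → kˣ) :
    stdKernel ψ y * check φ (y⁻¹ * x) = (prodAbs y : ℂ) * (hPsi ψ y * φ (x⁻¹ * y)) := by
  rw [stdKernel, check, mul_inv_rev, inv_inv, mul_comm (hPsi ψ y), mul_assoc]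
  rfl

/-- The substitution of $xy$ for $y$ turns the convolution into the Fourier integral, and the
density $|x_1y_1\cdots x_ny_n|$ releases the factor depending on $x$. -/
theorem mulConv_stdKernel (φ : (Fin n → kˣ) → ℂ) (x : Fin n → kˣ) :
    mulConv mn (stdKernel ψ) (check φ) x = (prodAbs x : ℂ) * stdFourier ψ mn φ x := by
  rw [mulConv, stdFourier_eq, integral_plusMeasure, ← integral_const_mul]
  simp_rw [stdKernel_mul_check]
  rw [← integral_mul_left_eq_self _ x]
  refine integral_congr_ae (ae_of_all _ fun y => ?_)
  simp only
  rw [inv_mul_cancel_left, prodAbs_mul]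
  push_cast
  ring

theorem integrable_stdKernel_mul_check (hψ : Continuous ψ) {φ : (Fin n → kˣ) → ℂ} (hφ : IsStdSchwartz φ)
    (x : Fin n → kˣ) : Integrable (fun y => stdKernel ψ y * check φ (y⁻¹ * x)) mn := by
  simp_rw [stdKernel_mul_check]
  rw [← integrable_plusMeasure_iff]
  obtain ⟨B, R, hB0, hR0, hB, hR⟩ := hφ.exists_bound
  obtain ⟨R', hR'⟩ := exists_mul_mem_polydisc x⁻¹ R
  refine integrable_of_polydisc (B := B) (plusMeasure_polydisc_lt_top mn R')
    ((measurable_hPsi hψ).mul (hφ.continuous.measurable.comp (measurable_const_mul _))) (fun y => ?_)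
    fun y hy => hR' _ (hR _ (right_ne_zero_of_mul hy))
  rw [norm_mul, norm_hPsi, one_mul]
  exact hB _

variable {mn} {mT : Measure (Fin r → kˣ)}

theorem integrable_kernel_mul [CharZero k] (hψ : Continuous ψ) (hψ1 : ψ ≠ 1)
    {ν : Fin r → ℤ} (hν : ∀ i, ∑ j, ν j * w i j = 1) {φ : (Fin n → kˣ) → ℂ} (hφ : IsStdSchwartz φ)
    (y : Fin n → kˣ) :
    Integrable (fun x => torusKernel w ψ mU (dualMap w (y * x)) * φ x) (plusMeasure mn) ∧
    ∫ x, torusKernel w ψ mU (dualMap w (y * x)) * φ x ∂(plusMeasure mn) =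
      pushforward w mU (stdFourier ψ mn φ) (dualMap w y) := by
  have hae : (fun x => pvKernel w ψ mU (dualMap w (y * x)) * φ x) =ᵐ[plusMeasure mn]
      fun x => torusKernel w ψ mU (dualMap w (y * x)) * φ x := by
    refine (plusMeasure_absolutelyContinuous mn).ae_le ?_
    filter_upwards [ae_absKernel_mul_lt_top w mU mn hψ hψ1 hν y] with x hx
    rw [torusKernel_eq_pvKernel w mU hψ hν hx]
  refine ⟨(integrable_pvKernel_mul w mU mn hψ hψ1 hν hφ y).congr hae, ?_⟩
  rw [← integral_congr_ae hae, integral_pvKernel_mul w mU mn hψ hψ1 hν hφ y]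

theorem torusFourier_pushforward [CharZero k] (hψ : Continuous ψ) (hψ1 : ψ ≠ 1)
    {ν : Fin r → ℤ} (hν : ∀ i, ∑ j, ν j * w i j = 1) (hT : IsQuotientMeasure w mn mU mT)
    {φ : (Fin n → kˣ) → ℂ} (hφ : IsStdSchwartz φ) (t : Fin r → kˣ) :
    torusFourier w ν ψ mU mT (pushforward w mU φ) t = pushforward w mU (stdFourier ψ mn φ) t := by
  by_cases ht : t ∈ Set.range (dualMap (k := k) w)
  · obtain ⟨y, rfl⟩ := ht
    obtain ⟨hi, he⟩ := integrable_kernel_mul (mn := mn) w mU hψ hψ1 hν hφ y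
    rw [← he, torusFourier, integral_plusMeasure]
    rw [integrable_plusMeasure_iff] at hi
    set g : (Fin r → kˣ) → ℂ := fun s =>
      torusKernel w ψ mU (dualMap w y * s) * (normAbs (charEval ν s) : ℂ) with hg
    have e : (fun x => (prodAbs x : ℂ) * (torusKernel w ψ mU (dualMap w (y * x)) * φ x)) =
        fun x => g (dualMap w x) * φ x := by
      funext x
      rw [hg]
      simp only
      rw [normAbs_charEval w hν, map_mul]
      ring
    rw [e] at hi ⊢
    rw [← (integral_mul_pushforward w mU hT hi).2]
    refine integral_congr_ae (ae_of_all _ fun s => ?_)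
    simp only [hg]
    ring
  -- Off the image the fibre is empty. A nonzero integrand would require both $s$ and $ts$ in the
  -- image, hence $t$ as well.
  · rw [pushforward_of_notMem w mU _ ht, torusFourier]
    refine (integral_congr_ae (ae_of_all _ fun s => ?_)).trans (integral_zero _ _)
    by_cases hs : s ∈ Set.range (dualMap (k := k) w)
    · simp [torusKernel_of_notMem w mU (mul_notMem_range w ht hs)]
    · simp [pushforward_of_notMem w mU φ hs]

/-- No translation invariance of `mT` is called upon: the integral is first lifted to $T_n(k)$, and
the change of variables uses the Haar measure `mn` there. -/
theorem mulConv_torusKernel [CharZero k] (hψ : Continuous ψ) (hψ1 : ψ ≠ 1)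
    {ν : Fin r → ℤ} (hν : ∀ i, ∑ j, ν j * w i j = 1) (hT : IsQuotientMeasure w mn mU mT)
    {φ : (Fin n → kˣ) → ℂ} (hφ : IsStdSchwartz φ) (t : Fin r → kˣ) :
    Integrable (fun s => torusKernelDensity w ν ψ mU s * check (pushforward w mU φ) (s⁻¹ * t)) mT ∧
    mulConv mT (torusKernelDensity w ν ψ mU) (check (pushforward w mU φ)) t =
      (normAbs (charEval ν t) : ℂ) * pushforward w mU (stdFourier ψ mn φ) t := by
  rw [mulConv]
  have ec : ∀ s, check (pushforward w mU φ) (s⁻¹ * t) = pushforward w mU φ (t⁻¹ * s) := by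
    intro s
    rw [check, mul_inv_rev, inv_inv]
  simp_rw [ec]
  by_cases ht : t ∈ Set.range (dualMap (k := k) w)
  · obtain ⟨y, rfl⟩ := ht
    obtain ⟨hi, he⟩ := integrable_kernel_mul (mn := mn) w mU hψ hψ1 hν hφ y
    simp_rw [pushforward_translate w mU hφ.continuous.measurable y]
    rw [integrable_plusMeasure_iff] at hi
    have hi2 := (hi.const_mul (prodAbs y : ℂ)).comp_mul_left y⁻¹
    have e : (fun x => (prodAbs y : ℂ) * ((prodAbs (y⁻¹ * x) : ℂ) *
        (torusKernel w ψ mU (dualMap w (y * (y⁻¹ * x))) * φ (y⁻¹ * x)))) =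
        fun x => torusKernelDensity w ν ψ mU (dualMap w x) * φ (y⁻¹ * x) := by
      funext x
      rw [torusKernelDensity, normAbs_charEval w hν, mul_inv_cancel_left]
      have : (prodAbs y : ℂ) * (prodAbs (y⁻¹ * x) : ℂ) = ((prodAbs x : ℝ) : ℂ) := by
        have h := prodAbs_mul y (y⁻¹ * x)
        rw [mul_inv_cancel_left] at h
        rw [h]
        push_cast
        rfl
      rw [← mul_assoc, this]
      ring
    rw [e] at hi2
    obtain ⟨h1, h2⟩ := integral_mul_pushforward w mU hT hi2
    refine ⟨h1, ?_⟩
    rw [h2, ← e, integral_mul_left_eq_self (μ := mn) (fun x => (prodAbs y : ℂ) * ((prodAbs x : ℂ) *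
        (torusKernel w ψ mU (dualMap w (y * x)) * φ x))) y⁻¹, integral_const_mul, ← integral_plusMeasure, he,
        normAbs_charEval w hν]
  · have hz : (fun s => torusKernelDensity w ν ψ mU s * pushforward w mU φ (t⁻¹ * s)) = fun _ => 0 := by
      funext s
      by_cases hs : s ∈ Set.range (dualMap (k := k) w)
      · have ht' : t⁻¹ ∉ Set.range (dualMap (k := k) w) := by
          rw [← MonoidHom.coe_range] at *
          exact fun h => ht (by simpa using inv_mem h)
        rw [pushforward_of_notMem w mU φ (mul_notMem_range w ht' hs), mul_zero]
      · rw [torusKernelDensity, torusKernel_of_notMem w mU hs, zero_mul, zero_mul]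
    rw [hz, pushforward_of_notMem w mU _ ht]
    simp

/-- The factor $|x_1\cdots x_n|$ is constant on the fibre, equal to $|\nu(t)|$, so it comes out of
the push-forward and matches the factor in `mulConv_torusKernel`. -/
theorem mulConv_stdKernel_ae_eq {ν : Fin r → ℤ} (hν : ∀ i, ∑ j, ν j * w i j = 1)
    (φ : (Fin n → kˣ) → ℂ) (t : Fin r → kˣ) :
    mulConv mn (stdKernel ψ) (check φ) =ᵐ[fibreMeasure w mU t]
      fun x => (normAbs (charEval ν t) : ℂ) * stdFourier ψ mn φ x := by
  filter_upwards [ae_fibreMeasure w mU t] with x hx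
  rw [mulConv_stdKernel, ← hx, normAbs_charEval w hν]

end Intertwining

end TorusFourier

end

/-! ### The theorem. -/

open TorusFourier in
theorem lemma6p1
    {k : Type*} [NontriviallyNormedField k] [IsUltrametricDist k] [LocallyCompactSpace k]
    [CharZero k] [MeasurableSpace k] [BorelSpace k]
    (ψ : AddChar k Circle) (hψ : Continuous ψ) (hψ1 : ψ ≠ 1)
    {n r : ℕ} (w : Fin n → Fin r → ℤ)
    (ν : Fin r → ℤ) (hν : ∀ i, ∑ j, ν j * w i j = 1)
    (mn : Measure (Fin n → kˣ)) [mn.IsHaarMeasure]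
    (mU : Measure (dualMap (k := k) w).ker) [mU.IsHaarMeasure]
    (mT : Measure (Fin r → kˣ)) (hT : IsQuotientMeasure w mn mU mT) :
    -- the principal value defining the kernel on `T(k)` converges almost everywhere
    (∀ᵐ t ∂mT, Tendsto (fun R : ℝ => truncKernel w ψ mU R t) atTop
      (𝓝 (torusKernel w ψ mU t))) ∧
    ∀ φ : (Fin n → kˣ) → ℂ, IsStdSchwartz φ →
      -- all other integrals converge absolutely
      (∀ t, Integrable φ (fibreMeasure w mU t)) ∧
      (∀ x, Integrable (fun y => stdKernel ψ y * check φ (y⁻¹ * x)) mn) ∧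
      (∀ t, Integrable (mulConv mn (stdKernel ψ) (check φ)) (fibreMeasure w mU t)) ∧
      (∀ t, Integrable (fun s => torusKernelDensity w ν ψ mU s *
        check (pushforward w mU φ) (s⁻¹ * t)) mT) ∧
      -- the identity of convolutions
      pushforward w mU (mulConv mn (stdKernel ψ) (check φ)) =
        mulConv mT (torusKernelDensity w ν ψ mU) (check (pushforward w mU φ)) ∧
      -- push-forward intertwines the two Fourier transforms
      pushforward w mU (stdFourier ψ mn φ) =
        torusFourier w ν ψ mU mT (pushforward w mU φ) := by
  refine ⟨?_, fun φ hφ => ?_⟩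
  · refine ae_of_ae_dualMap w mU hT ?_ fun t ht => ?_
    · filter_upwards [ae_absKernel_lt_top w mU hψ hψ1 hν mn] with x hx
      rw [torusKernel_eq_pvKernel w mU hψ hν hx]
      exact tendsto_truncKernel w mU hψ hν hx
    · simp_rw [torusKernel_of_notMem w mU ht, truncKernel_of_notMem w mU ht]
      exact tendsto_const_nhds
  · have hF := torusFourier_pushforward w mU hψ hψ1 hν hT hφ
    have hK := mulConv_torusKernel w mU hψ hψ1 hν hT hφ
    have hae := mulConv_stdKernel_ae_eq (ψ := ψ) (mn := mn) w mU hν φ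
    refine ⟨fun t => ?_, integrable_stdKernel_mul_check mn hψ hφ, fun t => ?_, fun t => (hK t).1, ?_, ?_⟩
    · obtain ⟨B, R, -, -, hB, hR⟩ := hφ.exists_bound
      exact integrable_of_polydisc (fibreMeasure_polydisc_lt_top w mU hν R t) hφ.continuous.measurable hB hR
    · exact ((integrable_stdFourier w mU mn hψ hψ1 hν hφ t).const_mul _).congr (hae t).symm
    · funext t
      rw [(hK t).2, pushforward, integral_congr_ae (hae t), integral_const_mul]
      rfl
    · funext t
      exact (hF t).symm
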